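/- Let $\Omega=\mathbb{R}^{\mathbb{N}}$, $\mathbb{N}=\{0,1,2,\dots\}$, carry the probability measure $P$ under which the coordinates $U_k(\omega)=\omega_k$ are i.i.d. uniform on $[-1,1]$, and let $E$ be the expectation. For $t\ge 0$ let $\Psi_t(\omega)$ be the sequence obtained from $\omega$ by replacing the coordinate of index $\lfloor t/2\rfloor$ by $t-2\lfloor t/2\rfloor-1$. For $X\in L^2(\Omega)$ put $$\nabla_tX:=X\circ\Psi_t-\frac12\int_{2\lfloor t/2\rfloor}^{2\lfloor t/2\rfloor+2}X\circ\Psi_s\,ds,\qquad t\ge0,$$ $$\mathrm{Dom}(\nabla):=\Big\{X\in L^2(\Omega):\ E\Big[\int_0^\infty|\nabla_tX|^2\,dt\Big]<\infty\Big\}.$$ For $n\ge1$ let $\Delta_n$ be the union of the boxes $[2k_1,2k_1+2]\times\cdots\times[2k_n,2k_n+2]$ over pairwise distinct $k_1,\dots,k_n\in\mathbb{N}$. For a symmetric function $f\in L^1(\mathbb{R}_+^n)\cap L^2(\mathbb{R}_+^n)$ that vanishes outside $\Delta_n$, the multiple stochastic integral is $$I_n(f):=\sum_{r=0}^n\frac{(-1)^{n-r}}{2^{n-r}}\binom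 nr\sum_{k_1,\dots,k_r\text{ distinct}}\int_{\mathbb{R}_+^{n-r}}f(2k_1+1+U_{k_1},\dots,2k_r+1+U_{k_r},y_1,\dots,y_{n-r})\,dy_1\cdots dy_{n-r},$$ and the $n$-th chaos $\mathcal{C}_n$ is the closure in $L^2(\Omega)$ of the space of these integrals (equivalently, the space of the $I_n(f)$ for all square-integrable such $f$, $I_n$ being extended by continuity). The spaces $\mathcal{C}_n$ are mutually orthogonal, and every centered $X\in L^2(\Omega)$ is the sum in $L^2(\Omega)$ of its orthogonal projections $X_n$ on $\mathcal{C}_n$, $n\ge1$. The inverse of the Ornstein-Uhlenbeck operator ($L=-n$ on $\mathcal{C}_n$) is $$L^{-1}X:=-\sum_{n\ge1}\frac1n X_n .$$ Let $\mathcal N$ be the standard normal distribution, let $d_W(X,\mathcal N)=\sup_h|E[h(X)]-\int h\,d\mathcal N|$, the supremum being over all $h:\mathbb{R}\to\mathbb{R}$ with Lipschitz constant at most $1$, and let $\langle u,v\rangle=\int_0^\infty u_tv_t\,dt$. **Proposition.** Let $X\in\mathrm{Dom}(\nabla)$ with $E[X]=0$. Then the integral $\langle\nabla_\cdot X,-\nabla_\cdot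 L^{-1}X\rangle$ converges absolutely almost surely, and $$d_W(X,\mathcal N)\le E\Big[\Big|1-\frac12\langle\nabla_\cdot X,-\nabla_\cdot L^{-1}X\rangle\Big|\Big]+\frac12E\Big[\int_0^\infty|\nabla_tL^{-1}X|\,|\nabla_tX|^2\,dt\Big]+\frac14E\Big[\int_0^\infty|\nabla_tL^{-1}X|\int_{2\lfloor t/2\rfloor}^{2\lfloor t/2\rfloor+2}|\nabla_sX|^2\,ds\,dt\Big],$$ where the last two terms are allowed to be $+\infty$. -/

import Mathlib

open MeasureTheory ProbabilityTheory

open scoped ENNReal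

noncomputable section

namespace UniformSeq

/-- The uniform law on the interval `[-1, 1]`. -/
def unif : Measure ℝ := volume[|Set.Icc (-1 : ℝ) 1]

instance : IsProbabilityMeasure unif :=
  cond_isProbabilityMeasure_of_finite (by simp) (by simp)

/-- The canonical space of the sequence `(U_k)`: here `U_k ω = ω k`. -/
abbrev Ω : Type := ℕ → ℝ

/-- The law on `Ω` under which the coordinates `U_k` are i.i.d. uniform on `[-1, 1]`. -/
def P : Measure Ω := Measure.infinitePi fun _ : ℕ => unif

instance : IsProbabilityMeasure P := by
  unfold P; infer_instance

/-- The block `[2⌊t/2⌋, 2⌊t/2⌋ + 2)` that contains `t ≥ 0`. -/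
def block (t : ℝ) : Set ℝ := Set.Ico (2 * (⌊t / 2⌋₊ : ℝ)) (2 * (⌊t / 2⌋₊ : ℝ) + 2)

/-- `Ψ_t`: the coordinate of index `⌊t/2⌋` is replaced by `t - 2⌊t/2⌋ - 1`. -/
def Psi (t : ℝ) (ω : Ω) : Ω :=
  Function.update ω ⌊t / 2⌋₊ (t - 2 * (⌊t / 2⌋₊ : ℝ) - 1)

/-- The finite difference operator
`∇_t X = X ∘ Ψ_t - (1/2) ∫_{block t} X ∘ Ψ_s ds`. -/
def nabla (t : ℝ) (X : Ω → ℝ) (ω : Ω) : ℝ :=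
  X (Psi t ω) - 1 / 2 * ∫ s in block t, X (Psi s ω)

/-- The domain of `∇`: the `X ∈ L²(Ω)` with `E ∫_0^∞ |∇_t X|² dt < ∞`. -/
def DomNabla : Set (Lp ℝ 2 P) :=
  {X | ∫⁻ ω, (∫⁻ t in Set.Ici (0 : ℝ), ‖nabla t X ω‖ₑ ^ 2) ∂P < ∞}

/-- `Δ_n`: the union of the boxes `∏ [2k_i, 2k_i + 2]` with pairwise distinct `k_1, …, k_n`. -/
def Delta (n : ℕ) : Set (Fin n → ℝ) :=
  ⋃ k : Fin n ↪ ℕ, Set.univ.pi fun i => Set.Icc (2 * (k i : ℝ)) (2 * (k i : ℝ) + 2)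

/-- The integrands of order `n` on which the multiple integral is given by a formula: symmetric
functions in `L¹ ∩ L²` vanishing outside `Δ_n` (in particular, for `n ≥ 1`, outside `ℝ₊ⁿ`). -/
structure IsKernel (n : ℕ) (f : (Fin n → ℝ) → ℝ) : Prop where
  symm : ∀ (σ : Equiv.Perm (Fin n)) (x : Fin n → ℝ), f (x ∘ σ) = f x
  zero_off : ∀ x, x ∉ Delta n → f x = 0
  integrable : Integrable f
  memLp : MemLp f 2

/-- The point `(2k_1 + 1 + U_{k_1}, …, 2k_r + 1 + U_{k_r}, y_1, …, y_{n-r})`. -/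
def mixedPoint {n r : ℕ} (ω : Ω) (k : Fin r → ℕ) (y : Fin (n - r) → ℝ) : Fin n → ℝ :=
  fun i => if h : (i : ℕ) < r then 2 * (k ⟨i, h⟩ : ℝ) + 1 + ω (k ⟨i, h⟩)
    else y ⟨i - r, by omega⟩

/-- The multiple stochastic integral `I_n(f)` of an integrand `f` as in `IsKernel`:
`∑_r (-1)^(n-r) / 2^(n-r) (n choose r) ∑_{k_1, …, k_r distinct} ∫ f(mixed point) dy`. -/
def multInt (n : ℕ) (f : (Fin n → ℝ) → ℝ) (ω : Ω) : ℝ :=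
  ∑ r ∈ Finset.range (n + 1), (-1 : ℝ) ^ (n - r) / 2 ^ (n - r) * (n.choose r : ℝ) *
    ∑' k : Fin r ↪ ℕ, ∫ y : Fin (n - r) → ℝ, f (mixedPoint ω k y)

/-- The `n`-th chaos `{I_n(f)}`, a closed subspace of `L²(Ω)`: since `I_n` is extended by
continuity to all square-integrable integrands, it is the closure of the space of
the integrals of the integrands in `L¹ ∩ L²`. -/
def chaos (n : ℕ) : Submodule ℝ (Lp ℝ 2 P) :=
  (Submodule.span ℝ
    {Z : Lp ℝ 2 P | ∃ f, IsKernel n f ∧ Z =ᵐ[P] multInt n f}).topologicalClosure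

instance (n : ℕ) : CompleteSpace (chaos n) := by
  unfold chaos; infer_instance

/-- The inverse of the Ornstein-Uhlenbeck operator on centered variables: if `X = ∑_{n ≥ 1} X_n`
with `X_n` in the `n`-th chaos, then `L⁻¹ X = -∑_{n ≥ 1} X_n / n` (convergence in `L²(Ω)`). The
component `X_n` is the orthogonal projection of `X` on the `n`-th chaos. -/
def Linv (X : Lp ℝ 2 P) : Lp ℝ 2 P :=
  -∑' n : ℕ, (1 / ((n : ℝ) + 1)) • (chaos (n + 1)).starProjection X

/-- The Wasserstein distance between two laws on `ℝ`, as the supremum of `|∫ h dμ - ∫ h dν|` over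
the functions `h` with Lipschitz constant at most `1`. -/
def dW (μ ν : Measure ℝ) : ℝ≥0∞ :=
  ⨆ (h : ℝ → ℝ) (_ : LipschitzWith 1 h), ‖∫ x, h x ∂μ - ∫ x, h x ∂ν‖ₑ

end UniformSeq

end

/-! The proof is Stein's method combined with an integration by parts on the Hoeffding
decomposition.

Stein's equation (`Stein.exists_solution`): for `h` with Lipschitz constant 1 there is `f` with
`f'(y) - y f(y) = h(y) - ∫ h dN`, `|f'| ≤ 1` and `|f(z) - f(y) - f'(y)(z - y)| ≤ (z - y)²`. It
remains to estimate `E[f'(X) - X f(X)]`.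

Discrete calculus: for `t = 2k + 1 + u` the number `∇_t X` is the value of `dif k X`, the part of
`X` centered in coordinate `k`, after that coordinate has been replaced by `u` (`nabla_shift`). The
spaces `hoeff S`, spanned by products of centered functions of the coordinates in a finite set `S`,
are orthogonal with dense sum, and `dif k` acts on `hoeff S` as the identity or as 0 according to
whether `k ∈ S`. Moreover `hoeff S` lies in the chaos of order `|S|` and is orthogonal to the others
(`hoeff_le_chaos`, `hoeff_isOrtho_chaos`), so `L⁻¹` acts on it as `-1/|S|` when `S` is nonempty.
Since `∑_k 1[k ∈ S] = |S|`, summing over `k` cancels this factor: `E[X Z] = -∑_k E[dif k (L⁻¹X) Z]`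
for `Z` in `L²` (`hasSum_inner_difLp_Linv`).

Conclusion: take `Z = f(X)` and expand `f` to first order in the resampled coordinate `k`. The
linear terms add up to `f'(X)` times `½⟨∇X, -∇L⁻¹X⟩` and, as `|f'| ≤ 1`, give the first term of the
bound. The quadratic remainders (`remainder`) involve the squared difference of two independent
resamplings of `X`; its mean splits into a square and a variance (`remainder_eq`), which produce the
other two terms. -/

namespace Stein

/-! ### Stein's equation for Lipschitz test functions. -/

open Real Set Filter Topology

noncomputable section

/-- The unnormalised standard Gaussian density. -/
def rho (u : ℝ) : ℝ := exp (-u ^ 2 / 2)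

lemma rho_pos (u : ℝ) : 0 < rho u := exp_pos _

lemma rho_neg (u : ℝ) : rho (-u) = rho u := by simp [rho]

lemma continuous_rho : Continuous rho := by unfold rho; fun_prop

lemma hasDerivAt_rho (x : ℝ) : HasDerivAt rho (-x * rho x) x := by
  have h : HasDerivAt (fun u : ℝ => -u ^ 2 / 2) (-x) x := by
    refine ((hasDerivAt_pow 2 x).fun_neg.div_const 2).congr_deriv ?_
    norm_num
    ring
  exact h.exp.congr_deriv (mul_comm _ _)

lemma rho_eq (u : ℝ) : rho u = exp (-(1 / 2) * u ^ 2) := by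
  unfold rho; congr 1; ring

lemma integrable_rho : Integrable rho := by
  have := integrable_exp_neg_mul_sq (b := 1 / 2) (by norm_num)
  exact this.congr (ae_of_all _ fun u => (rho_eq u).symm)

lemma integrable_mul_rho : Integrable fun u : ℝ => u * rho u := by
  have := integrable_mul_exp_neg_mul_sq (b := 1 / 2) (by norm_num)
  exact this.congr (ae_of_all _ fun u => by simp only [rho_eq])

lemma tendsto_rho_atTop : Tendsto rho atTop (𝓝 0) := by
  have h : Tendsto (fun u : ℝ => u ^ 2 / 2) atTop atTop :=
    (tendsto_pow_atTop (by norm_num)).atTop_div_const (by norm_num)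
  refine (tendsto_exp_neg_atTop_nhds_zero.comp h).congr fun u => ?_
  simp only [Function.comp, rho]; congr 1; ring

lemma exp_mul_rho (x : ℝ) : exp (x ^ 2 / 2) * rho x = 1 := by
  rw [rho, ← exp_add]; simp; ring

/-- The Gaussian tail. -/
def tail (x : ℝ) : ℝ := ∫ u in Ioi x, rho u

lemma hasDerivAt_integral_Iic {g : ℝ → ℝ} (hc : Continuous g) (hi : Integrable g) (x : ℝ) :
    HasDerivAt (fun y => ∫ u in Iic y, g u) (g x) x := by
  have h : (fun y => ∫ u in Iic y, g u) =
      fun y => (∫ u in Iic (0 : ℝ), g u) + ∫ u in (0)..y, g u := by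
    ext y
    have := intervalIntegral.integral_Iic_sub_Iic (a := 0) (b := y) (f := g)
      hi.integrableOn hi.integrableOn
    linarith
  rw [h]
  exact (intervalIntegral.integral_hasDerivAt_right (hc.intervalIntegrable _ _)
    hc.stronglyMeasurable.stronglyMeasurableAtFilter hc.continuousAt).const_add _

lemma integral_Iic_add_Ioi' {g : ℝ → ℝ} (hi : Integrable g) (x : ℝ) :
    (∫ u in Iic x, g u) + ∫ u in Ioi x, g u = ∫ u, g u :=
  intervalIntegral.integral_Iic_add_Ioi hi.integrableOn hi.integrableOn

lemma hasDerivAt_tail (x : ℝ) : HasDerivAt tail (-rho x) x := by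
  have h : tail = fun y => (∫ u, rho u) - ∫ u in Iic y, rho u := by
    ext y
    have := integral_Iic_add_Ioi' integrable_rho y
    unfold tail; linarith
  rw [h]
  exact (hasDerivAt_integral_Iic continuous_rho integrable_rho x).const_sub _

lemma tendsto_tail_atTop : Tendsto tail atTop (𝓝 0) := by
  have h : tail = fun y => (∫ u, rho u) - ∫ u in Iic y, rho u := by
    ext y
    have := integral_Iic_add_Ioi' integrable_rho y
    unfold tail; linarith
  have h2 := (aecover_Iic (μ := volume) (tendsto_id (α := ℝ))).integral_tendsto_of_countably_generated
    integrable_rho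
  rw [h]
  simpa using h2.const_sub (∫ u, rho u)

lemma tail_nonneg (x : ℝ) : 0 ≤ tail x :=
  setIntegral_nonneg measurableSet_Ioi fun u _ => (rho_pos u).le

lemma integral_Iic_rho (x : ℝ) : ∫ u in Iic x, rho u = tail (-x) := by
  rw [tail, ← integral_comp_neg_Iic]
  simp [rho_neg]

lemma integral_Ioi_mul_rho (x : ℝ) : ∫ u in Ioi x, u * rho u = rho x := by
  have := integral_Ioi_of_hasDerivAt_of_tendsto' (a := x) (f := fun u => -rho u)
    (f' := fun u => u * rho u) (m := 0) (fun u _ => by simpa using (hasDerivAt_rho u).fun_neg)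
    integrable_mul_rho.integrableOn (by simpa using tendsto_rho_atTop.neg)
  simpa using this

lemma integral_mul_rho : ∫ u, u * rho u = 0 := by
  have h := integral_neg_eq_self (fun u => u * rho u) volume
  simp only [rho_neg, neg_mul, integral_neg] at h
  linarith

/-- Birnbaum's lower bound for the Gaussian tail. -/
lemma birnbaum (x : ℝ) : rho x * ((√(x ^ 2 + 4) - x) / 2) ≤ tail x := by
  set r : ℝ → ℝ := fun y => (√(y ^ 2 + 4) - y) / 2 with hr
  have hs : ∀ y : ℝ, 0 < √(y ^ 2 + 4) := fun y => by positivity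
  have hsq : ∀ y : ℝ, √(y ^ 2 + 4) ^ 2 = y ^ 2 + 4 := fun y => sq_sqrt (by positivity)
  have hd : ∀ y, HasDerivAt (fun y => tail y - rho y * r y)
      (-rho y - (-y * rho y * r y + rho y * ((y / √(y ^ 2 + 4) - 1) / 2))) y := by
    intro y
    have h1 : HasDerivAt (fun y : ℝ => y ^ 2 + 4) (2 * y) y := by
      simpa using (hasDerivAt_pow 2 y).add_const 4
    have h2 : HasDerivAt r ((y / √(y ^ 2 + 4) - 1) / 2) y := by
      refine (((h1.sqrt (by positivity)).fun_sub (hasDerivAt_id' y)).div_const 2).congr_deriv ?_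
      have := hs y
      field_simp
    exact (hasDerivAt_tail y).sub ((hasDerivAt_rho y).mul h2)
  have hanti : Antitone (fun y => tail y - rho y * r y) := by
    refine antitone_of_hasDerivAt_nonpos hd fun y => ?_
    have e : -rho y - (-y * rho y * r y + rho y * ((y / √(y ^ 2 + 4) - 1) / 2))
      = -(rho y * (1 - y * r y + (y / √(y ^ 2 + 4) - 1) / 2)) := by ring
    refine e.trans_le (neg_nonpos.2 ?_)
    refine mul_nonneg (rho_pos y).le ?_
    have hsy := hs y
    have hq := hsq y
    simp only [hr]
    generalize √(y ^ 2 + 4) = s at *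
    -- Since `s² - y² = 4`, the factor `s² - s y - 2` is `(s - y)² / 2`, so the whole expression is
    -- `(s - y)³ / (8 s)`, which is nonnegative.
    have e2 : 1 - y * ((s - y) / 2) + (y / s - 1) / 2 = (s ^ 2 - s * y - 2) * (s - y) / (4 * s) := by
      have : y ^ 2 = s ^ 2 - 4 := by linarith
      field_simp
      ring_nf
      rw [this]; ring
    rw [e2]
    have hy : |y| ≤ s := abs_le_of_sq_le_sq (by nlinarith) hsy.le
    have := abs_le.1 hy
    have : 0 ≤ s ^ 2 - s * y - 2 := by nlinarith [sq_nonneg (s - y)]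
    have : 0 ≤ s - y := by linarith
    positivity
  have hlim : Tendsto (fun y => tail y - rho y * r y) atTop (𝓝 0) := by
    have : Tendsto (fun y => rho y * r y) atTop (𝓝 0) := by
      refine squeeze_zero' ?_ ?_ tendsto_rho_atTop
      · filter_upwards [eventually_ge_atTop 0] with y hy
        refine mul_nonneg (rho_pos y).le ?_
        have : y ≤ √(y ^ 2 + 4) := le_sqrt_of_sq_le (by linarith)
        simp only [hr]; linarith
      · filter_upwards [eventually_ge_atTop 0] with y hy
        refine mul_le_of_le_one_right (rho_pos y).le ?_
        have : √(y ^ 2 + 4) ≤ y + 2 := by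
          rw [sqrt_le_left (by linarith)]; nlinarith
        simp only [hr]; linarith
    simpa using tendsto_tail_atTop.sub this
  exact sub_nonneg.1 (hanti.le_of_tendsto hlim x)

/-- A weakening of Birnbaum's bound to the form needed for the derivative of `x * sol g x`; for `x ≤
0` it is a matter of signs. -/
lemma mul_rho_le_tail (x : ℝ) : x * rho x ≤ (1 + x ^ 2) * tail x := by
  rcases le_total x 0 with hx | hx
  · have := mul_nonneg (by positivity : 0 ≤ 1 + x ^ 2) (tail_nonneg x)
    nlinarith [rho_pos x]
  · have h := birnbaum x
    have h2 : x ≤ (1 + x ^ 2) * ((√(x ^ 2 + 4) - x) / 2) := by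
      have hq : √(x ^ 2 + 4) ^ 2 = x ^ 2 + 4 := sq_sqrt (by positivity)
      have h3 : x + 2 * x / (1 + x ^ 2) ≤ √(x ^ 2 + 4) := by
        apply le_sqrt_of_sq_le
        have : (x + 2 * x / (1 + x ^ 2)) ^ 2 = x ^ 2 + 4 - 4 / (1 + x ^ 2) ^ 2 := by
          field_simp; ring
        rw [this]
        have : 0 ≤ 4 / (1 + x ^ 2) ^ 2 := by positivity
        linarith
      have : (1 + x ^ 2) * (2 * x / (1 + x ^ 2)) = 2 * x := by field_simp
      have := mul_le_mul_of_nonneg_left h3 (by positivity : 0 ≤ 1 + x ^ 2)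
      nlinarith
    have h4 := mul_le_mul_of_nonneg_left h (by positivity : 0 ≤ 1 + x ^ 2)
    have h5 := mul_le_mul_of_nonneg_right h2 (rho_pos x).le
    linarith

/-- The solution of Stein's equation `f' - x f = g` for a centered `g`. -/
def sol (g : ℝ → ℝ) (x : ℝ) : ℝ := exp (x ^ 2 / 2) * ∫ u in Iic x, g u * rho u

section

variable {g : ℝ → ℝ}

lemma hasDerivAt_sol (hc : Continuous g) (hi : Integrable fun u => g u * rho u) (x : ℝ) :
    HasDerivAt (sol g) (x * sol g x + g x) x := by
  have h1 : HasDerivAt (fun u : ℝ => exp (u ^ 2 / 2)) (exp (x ^ 2 / 2) * x) x := by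
    have h : HasDerivAt (fun u : ℝ => u ^ 2 / 2) x x := by
      refine ((hasDerivAt_pow 2 x).div_const 2).congr_deriv ?_
      norm_num
    exact h.exp
  refine (h1.mul (hasDerivAt_integral_Iic (hc.mul continuous_rho) hi x)).congr_deriv ?_
  have := exp_mul_rho x
  unfold sol
  rw [Pi.mul_apply]
  linear_combination (g x) * this

lemma sol_eq_tail (hi : Integrable fun u => g u * rho u) (h0 : ∫ u, g u * rho u = 0) (x : ℝ) :
    sol g x = -(exp (x ^ 2 / 2) * ∫ u in Ioi x, g u * rho u) := by
  have := integral_Iic_add_Ioi' hi x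
  rw [h0] at this
  rw [sol, eq_neg_of_add_eq_zero_left this]; ring

lemma sol_le_of_monotone (hi : Integrable fun u => g u * rho u)
    (hm : Monotone g) (x : ℝ) : sol g x ≤ g x * (exp (x ^ 2 / 2) * tail (-x)) := by
  have : ∫ u in Iic x, g u * rho u ≤ ∫ u in Iic x, g x * rho u :=
    setIntegral_mono_on hi.integrableOn (integrable_rho.const_mul _).integrableOn measurableSet_Iic
      fun u hu => mul_le_mul_of_nonneg_right (hm hu) (rho_pos u).le
  rw [integral_const_mul, integral_Iic_rho] at this
  have := mul_le_mul_of_nonneg_left this (exp_pos (x ^ 2 / 2)).le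
  simp only [sol]; linarith

lemma sol_le_of_monotone' (hi : Integrable fun u => g u * rho u) (h0 : ∫ u, g u * rho u = 0)
    (hm : Monotone g) (x : ℝ) : sol g x ≤ -(g x * (exp (x ^ 2 / 2) * tail x)) := by
  have : ∫ u in Ioi x, g x * rho u ≤ ∫ u in Ioi x, g u * rho u :=
    setIntegral_mono_on (integrable_rho.const_mul _).integrableOn hi.integrableOn measurableSet_Ioi
      fun u hu => mul_le_mul_of_nonneg_right (hm (le_of_lt hu)) (rho_pos u).le
  rw [integral_const_mul] at this
  have := mul_le_mul_of_nonneg_left this (exp_pos (x ^ 2 / 2)).le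
  rw [sol_eq_tail hi h0]
  unfold tail; linarith

/-- For monotone `g` the integral over the left half-line and the one over the right half-line each
give a bound by a multiple of `g x`, with opposite signs; the sign of `g x` tells which of them to
use. -/
lemma sol_nonpos (hi : Integrable fun u => g u * rho u) (h0 : ∫ u, g u * rho u = 0)
    (hm : Monotone g) (x : ℝ) : sol g x ≤ 0 := by
  have h1 := sol_le_of_monotone hi hm x
  have h2 := sol_le_of_monotone' hi h0 hm x
  have a := mul_nonneg (exp_pos (x ^ 2 / 2)).le (tail_nonneg x)
  have b := mul_nonneg (exp_pos (x ^ 2 / 2)).le (tail_nonneg (-x))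
  rcases le_total (g x) 0 with h | h
  · exact h1.trans (mul_nonpos_of_nonpos_of_nonneg h b)
  · have := mul_nonneg h a; linarith

lemma mills (x : ℝ) : x ≤ (1 + x ^ 2) * (exp (x ^ 2 / 2) * tail x) := by
  have h := mul_le_mul_of_nonneg_left (mul_rho_le_tail x) (exp_pos (x ^ 2 / 2)).le
  have := exp_mul_rho x
  have e : exp (x ^ 2 / 2) * (x * rho x) = x := by linear_combination x * this
  linarith

/-- The left side is the derivative of `x * sol g x`, that is `(1 + x²) * sol g x + x * g x`. The
one-sided bounds on `sol g x`, combined with `mills` at `x` or at `-x`, settle its sign. -/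
lemma deriv_mul_sol_nonpos (hi : Integrable fun u => g u * rho u) (h0 : ∫ u, g u * rho u = 0)
    (hm : Monotone g) (x : ℝ) : sol g x + x * (x * sol g x + g x) ≤ 0 := by
  have h1 := sol_le_of_monotone hi hm x
  have h2 := sol_le_of_monotone' hi h0 hm x
  have h3 := sol_nonpos hi h0 hm x
  have m1 := mills x
  have m2 := mills (-x)
  rw [neg_sq] at m2
  have hx2 : 0 < 1 + x ^ 2 := by positivity
  rcases le_total (g x) 0 with h | h
  · have := mul_le_mul_of_nonneg_left h1 hx2.le
    have := mul_le_mul_of_nonpos_left m2 h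
    linarith
  · have := mul_le_mul_of_nonneg_left h2 hx2.le
    have := mul_le_mul_of_nonneg_left m1 h
    linarith

lemma sol_id (x : ℝ) : sol (fun u => u) x = -1 := by
  rw [sol_eq_tail integrable_mul_rho integral_mul_rho, integral_Ioi_mul_rho, exp_mul_rho]

lemma sol_id_add (hi : Integrable fun u => g u * rho u) (x : ℝ) :
    sol (fun u => u + g u) x = -1 + sol g x := by
  rw [← sol_id x]
  simp only [sol, add_mul]
  rw [integral_add integrable_mul_rho.integrableOn hi.integrableOn]; ring

lemma sol_neg (x : ℝ) : sol (fun u => -g u) x = -sol g x := by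
  simp [sol, integral_neg]

/-- One-sided bounds coming from monotonicity of `x + g x`. -/
lemma sol_bounds_aux (hi : Integrable fun u => g u * rho u) (h0 : ∫ u, g u * rho u = 0)
    (hl : LipschitzWith 1 g) (x : ℝ) :
    sol g x ≤ 1 ∧ sol g x + x * (x * sol g x + g x) ≤ 1 := by
  have hi' : Integrable fun u => (u + g u) * rho u :=
    (integrable_mul_rho.add hi).congr (ae_of_all _ fun u => by simp [add_mul])
  have h0' : ∫ u, (u + g u) * rho u = 0 := by
    simp only [add_mul]
    rw [integral_add integrable_mul_rho hi, integral_mul_rho, h0, add_zero]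
  -- Adding the identity makes a 1-Lipschitz function monotone. As `sol` is linear and sends the
  -- identity to the constant `-1`, the sign statements for monotone data become bounds by 1 for
  -- `g`.
  have hm : Monotone fun u => u + g u := by
    intro a b hab
    have := hl.dist_le_mul a b
    rw [Real.dist_eq, Real.dist_eq, abs_of_nonpos (by linarith : a - b ≤ 0)] at this
    have := (abs_le.1 this).2
    simp at this ⊢
    linarith
  have h1 := sol_nonpos hi' h0' hm x
  have h2 := deriv_mul_sol_nonpos hi' h0' hm x
  rw [sol_id_add hi] at h1 h2
  constructor
  · linarith
  · linarith

lemma sol_bounds (hi : Integrable fun u => g u * rho u) (h0 : ∫ u, g u * rho u = 0)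
    (hl : LipschitzWith 1 g) (x : ℝ) :
    |sol g x| ≤ 1 ∧ |sol g x + x * (x * sol g x + g x)| ≤ 1 := by
  have h1 := sol_bounds_aux hi h0 hl x
  have h2 := sol_bounds_aux (g := fun u => -g u) (by simpa using hi.neg)
    (by simp [integral_neg, h0]) hl.neg x
  rw [sol_neg] at h2
  constructor
  · rw [abs_le]; constructor <;> linarith
  · rw [abs_le]; constructor <;> linarith

/-- The derivative is `x * sol g x + g x`, a sum of two 1-Lipschitz functions; hence the constant 2,
which becomes 1 in the second order Taylor bound. -/
lemma lipschitz_deriv_sol (hi : Integrable fun u => g u * rho u) (h0 : ∫ u, g u * rho u = 0)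
    (hl : LipschitzWith 1 g) (x y : ℝ) :
    |(y * sol g y + g y) - (x * sol g x + g x)| ≤ 2 * |y - x| := by
  have hd : ∀ z, HasDerivAt (fun z => z * sol g z) (sol g z + z * (z * sol g z + g z)) z := by
    intro z
    simpa using (hasDerivAt_id' z).fun_mul (hasDerivAt_sol hl.continuous hi z)
  have h1 := convex_univ.norm_image_sub_le_of_norm_hasDerivWithin_le (C := 1)
    (f := fun z => z * sol g z) (x := x) (y := y)
    (fun z _ => (hd z).hasDerivWithinAt) (fun z _ => (sol_bounds hi h0 hl z).2) trivial trivial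
  have h2 := hl.dist_le_mul y x
  simp only [Real.norm_eq_abs, Real.dist_eq, NNReal.coe_one] at h1 h2
  calc _ = |(y * sol g y - x * sol g x) + (g y - g x)| := by congr 1; ring
    _ ≤ _ := abs_add_le _ _
    _ ≤ _ := by linarith

lemma taylor_of_lipschitz_deriv {f f' : ℝ → ℝ} (hf : ∀ x, HasDerivAt f (f' x) x)
    (hl : ∀ x y, |f' y - f' x| ≤ 2 * |y - x|) (x y : ℝ) :
    |f y - f x - f' x * (y - x)| ≤ (y - x) ^ 2 := by
  have hd : ∀ z, HasDerivAt (fun z => f z - f' x * z) (f' z - f' x) z := fun z => by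
    simpa using (hf z).fun_sub ((hasDerivAt_id z).const_mul (f' x))
  have hq : ∀ z, HasDerivAt (fun z => (z - x) ^ 2) (2 * (z - x)) z := fun z => by
    simpa using ((hasDerivAt_id' z).sub_const x).fun_pow 2
  have key : ∀ s : ℝ, (s = 1 ∨ s = -1) → s * (f y - f x - f' x * (y - x)) ≤ (y - x) ^ 2 := by
    intro s hs
    have hs' : ∀ a b : ℝ, |a| ≤ b → s * a ≤ b := by
      rintro a b h
      have := abs_le.1 h
      rcases hs with rfl | rfl <;> linarith
    set k : ℝ → ℝ := fun z => (z - x) ^ 2 - s * (f z - f' x * z)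
    have hk : ∀ z, HasDerivAt k (2 * (z - x) - s * (f' z - f' x)) z := fun z =>
      (hq z).sub ((hd z).const_mul s)
    have hkc : Continuous k := continuous_iff_continuousAt.2 fun z => (hk z).continuousAt
    have : k x ≤ k y := by
      rcases le_total x y with h | h
      · refine (monotoneOn_of_deriv_nonneg (convex_Ici x) hkc.continuousOn
          (fun z _ => (hk z).differentiableAt.differentiableWithinAt) fun z hz => ?_)
          self_mem_Ici h h
        rw [interior_Ici, mem_Ioi] at hz
        rw [(hk z).deriv]
        have := hs' _ _ (hl x z)
        rw [abs_of_nonneg (by linarith)] at this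
        linarith
      · refine (antitoneOn_of_deriv_nonpos (convex_Iic x) hkc.continuousOn
          (fun z _ => (hk z).differentiableAt.differentiableWithinAt) fun z hz => ?_)
          h self_mem_Iic h
        rw [interior_Iic, mem_Iio] at hz
        rw [(hk z).deriv]
        have h3 := hl x z
        rw [abs_of_nonpos (by linarith : z - x ≤ 0)] at h3
        have := hs' (-(f' z - f' x)) (2 * -(z - x)) (by rw [abs_neg]; exact h3)
        linarith
    simp only [k] at this
    nlinarith
  rw [abs_le]
  have h1 := key 1 (Or.inl rfl)
  have h2 := key (-1) (Or.inr rfl)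
  constructor <;> linarith

/-- The bound on the derivative for nonnegative arguments. -/
lemma abs_deriv_sol_le_of_nonneg (hi : Integrable fun u => g u * rho u)
    (h0 : ∫ u, g u * rho u = 0) (hl : LipschitzWith 1 g) (hg : ∀ x, |g x| ≤ √(x ^ 2 + 1))
    {x : ℝ} (hx : 0 ≤ x) : |x * sol g x + g x| ≤ 1 := by
  set e := exp (x ^ 2 / 2) with he
  have hepos : 0 < e := exp_pos _
  have her : e * rho x = 1 := exp_mul_rho x
  set q := 1 - x * (e * tail x) with hq
  have i1 : IntegrableOn (fun u => (u - x) * rho u) (Ioi x) := by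
    refine ((integrable_mul_rho.sub (integrable_rho.const_mul x)).congr
      (ae_of_all _ fun u => ?_)).integrableOn
    simp [sub_mul]
  have i2 : IntegrableOn (fun u => (g u - g x) * rho u) (Ioi x) := by
    refine ((hi.sub (integrable_rho.const_mul (g x))).congr
      (ae_of_all _ fun u => ?_)).integrableOn
    simp [sub_mul]
  have e1 : ∫ u in Ioi x, (u - x) * rho u = rho x - x * tail x := by
    simp only [sub_mul]
    rw [integral_sub integrable_mul_rho.integrableOn (integrable_rho.const_mul x).integrableOn,
      integral_Ioi_mul_rho, integral_const_mul, tail]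
  have e2 : ∫ u in Ioi x, (g u - g x) * rho u = (∫ u in Ioi x, g u * rho u) - g x * tail x := by
    simp only [sub_mul]
    rw [integral_sub hi.integrableOn (integrable_rho.const_mul _).integrableOn,
      integral_const_mul, tail]
  have b : |∫ u in Ioi x, (g u - g x) * rho u| ≤ rho x - x * tail x := by
    rw [← e1]
    refine (abs_integral_le_integral_abs).trans (setIntegral_mono_on i2.abs i1 measurableSet_Ioi ?_)
    intro u hu
    rw [mem_Ioi] at hu
    rw [abs_mul, abs_of_pos (rho_pos u)]
    refine mul_le_mul_of_nonneg_right ?_ (rho_pos u).le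
    have := hl.dist_le_mul u x
    rw [Real.dist_eq, Real.dist_eq, abs_of_pos (by linarith : 0 < u - x)] at this
    simpa using this
  have bq : e * (rho x - x * tail x) = q := by rw [hq]; linear_combination her
  have q0 : 0 ≤ q := by
    rw [← bq]; exact mul_nonneg hepos.le ((abs_nonneg _).trans b)
  -- Centering the tail integral at `g x` isolates the factor `q`, the normalised mean of `u - x`
  -- over the tail. The Lipschitz property bounds the rest by `x * q`, so only `(√(x² + 1) + x) * q
  -- ≤ 1` is left.
  have eq : x * sol g x + g x = g x * q - x * (e * ∫ u in Ioi x, (g u - g x) * rho u) := by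
    rw [sol_eq_tail hi h0, e2, hq]; ring
  have hs1 : √(x ^ 2 + 1) ^ 2 = x ^ 2 + 1 := sq_sqrt (by positivity)
  have hs4 : √(x ^ 2 + 4) ^ 2 = x ^ 2 + 4 := sq_sqrt (by positivity)
  set r := (√(x ^ 2 + 4) - x) / 2 with hr
  have hr1 : r ^ 2 + x * r = 1 := by rw [hr]; nlinarith
  have hrpos : 0 < r := by
    have : x < √(x ^ 2 + 4) := lt_sqrt_of_sq_lt (by linarith)
    rw [hr]; linarith
  have hqr : q ≤ r ^ 2 := by
    have h := mul_le_mul_of_nonneg_left (birnbaum x) hepos.le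
    have : e * (rho x * r) = r := by linear_combination r * her
    rw [← hr, this] at h
    have := mul_le_mul_of_nonneg_left h hx
    rw [hq]; linarith
  -- In the variable `r`, with `x = (1 - r²) / r` and `0 < r ≤ 1`, squaring reduces this to `1 - 2r
  -- + 2r³ - r⁴ = (1 - r)³ (1 + r) ≥ 0`.
  have hfin : (√(x ^ 2 + 1) + x) * r ^ 2 ≤ 1 := by
    have hx' : x = (1 - r ^ 2) / r := by field_simp; linarith
    have hr_le : r ≤ 1 := by nlinarith
    have hb : √(x ^ 2 + 1) ≤ 1 / r ^ 2 - x := by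
      rw [sqrt_le_left]
      · rw [hx']; field_simp
        have h4 : r ^ 4 ≤ 1 := pow_le_one₀ hrpos.le hr_le
        have h3 : 0 ≤ (1 - r) := by linarith
        nlinarith [mul_nonneg h3 (sq_nonneg (1 - r)),
          mul_nonneg (mul_nonneg h3 (sq_nonneg (1 - r))) hrpos.le]
      · have : 1 / r ^ 2 - x = (1 - r * (1 - r ^ 2)) / r ^ 2 := by rw [hx']; field_simp
        rw [this]
        have : 0 ≤ 1 - r * (1 - r ^ 2) := by nlinarith
        positivity
    calc (√(x ^ 2 + 1) + x) * r ^ 2 ≤ (1 / r ^ 2) * r ^ 2 :=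
          mul_le_mul_of_nonneg_right (by linarith) (sq_nonneg r)
      _ = 1 := by field_simp
  rw [eq]
  calc |g x * q - x * (e * ∫ u in Ioi x, (g u - g x) * rho u)|
      ≤ |g x * q| + |x * (e * ∫ u in Ioi x, (g u - g x) * rho u)| := abs_sub _ _
    _ = |g x| * q + x * (e * |∫ u in Ioi x, (g u - g x) * rho u|) := by
        rw [abs_mul, abs_mul, abs_mul, abs_of_nonneg q0, abs_of_nonneg hx, abs_of_pos hepos]
    _ ≤ √(x ^ 2 + 1) * q + x * (e * (rho x - x * tail x)) := by
        gcongr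
        exact hg x
    _ = (√(x ^ 2 + 1) + x) * q := by rw [bq]; ring
    _ ≤ (√(x ^ 2 + 1) + x) * r ^ 2 := by gcongr
    _ ≤ 1 := hfin

lemma sol_comp_neg (hi : Integrable fun u => g u * rho u)
    (h0 : ∫ u, g u * rho u = 0) (x : ℝ) : sol (fun u => g (-u)) x = -sol g (-x) := by
  rw [sol_eq_tail hi h0, neg_neg, sol, ← integral_comp_neg_Iic]
  simp [rho_neg]

lemma abs_deriv_sol_le (hi : Integrable fun u => g u * rho u)
    (h0 : ∫ u, g u * rho u = 0) (hl : LipschitzWith 1 g) (hg : ∀ x, |g x| ≤ √(x ^ 2 + 1))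
    (x : ℝ) : |x * sol g x + g x| ≤ 1 := by
  rcases le_total 0 x with hx | hx
  · exact abs_deriv_sol_le_of_nonneg hi h0 hl hg hx
  · have hi' : Integrable fun u => g (-u) * rho u := by
      simpa [rho_neg] using hi.comp_neg
    have h0' : ∫ u, g (-u) * rho u = 0 := by
      rw [← h0, ← integral_neg_eq_self (fun u => g u * rho u)]
      simp [rho_neg]
    have hl' : LipschitzWith 1 fun u => g (-u) := by
      refine LipschitzWith.of_dist_le_mul fun a b => ?_
      simpa using hl.dist_le_mul (-a) (-b)
    have := abs_deriv_sol_le_of_nonneg hi' h0' hl' (fun x => by simpa using hg (-x))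
      (x := -x) (by linarith)
    rw [sol_comp_neg hi h0] at this
    simpa using this

end

lemma gaussianPDFReal_eq (x : ℝ) : gaussianPDFReal 0 1 x = (√(2 * π))⁻¹ * rho x := by
  simp [gaussianPDFReal, rho]

lemma integrable_id_gaussian : Integrable (fun x : ℝ => x) (gaussianReal 0 1) :=
  (memLp_id_gaussianReal (μ := 0) (v := 1) 1).integrable le_rfl

lemma integrable_sq_gaussian : Integrable (fun x : ℝ => x ^ 2) (gaussianReal 0 1) :=
  (memLp_id_gaussianReal (μ := 0) (v := 1) 2).integrable_sq

lemma integral_sq_gaussian : ∫ x, x ^ 2 ∂(gaussianReal 0 1) = 1 := by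
  have h := variance_fun_id_gaussianReal (μ := 0) (v := 1)
  rw [variance_of_integral_eq_zero (by fun_prop) (by simp)] at h
  simpa using h

/-- A Lipschitz function has a bounded solution of Stein's equation, with first derivative bounded
by `1` and second order Taylor remainder bounded by the square of the increment. -/
theorem exists_solution {h : ℝ → ℝ} (hh : LipschitzWith 1 h) :
    ∃ f f' : ℝ → ℝ, (∀ x, HasDerivAt f (f' x) x) ∧ Continuous f' ∧
      (∀ x, f' x - x * f x = h x - ∫ y, h y ∂(gaussianReal 0 1)) ∧
      (∀ x, |f x| ≤ 1) ∧ (∀ x, |f' x| ≤ 1) ∧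
      ∀ x y, |f y - f x - f' x * (y - x)| ≤ (y - x) ^ 2 := by
  set m := ∫ y, h y ∂(gaussianReal 0 1) with hm
  set g : ℝ → ℝ := fun x => h x - m with hg
  have hl : LipschitzWith 1 g := by
    refine LipschitzWith.of_dist_le_mul fun x y => ?_
    simpa [hg, Real.dist_eq] using hh.dist_le_mul x y
  have hbd : ∀ u, |h u| ≤ |h 0| + |u| := fun u => by
    have := hh.dist_le_mul u 0
    simp only [Real.dist_eq, NNReal.coe_one, one_mul, sub_zero] at this
    have h2 := abs_sub_abs_le_abs_sub (h u) (h 0)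
    linarith
  have hhi : Integrable h (gaussianReal 0 1) := by
    refine Integrable.mono' ((integrable_const |h 0|).add integrable_id_gaussian.abs)
      hh.continuous.aestronglyMeasurable (ae_of_all _ fun u => ?_)
    exact hbd u
  have hhr : Integrable fun u => h u * rho u := by
    refine Integrable.mono' ((integrable_rho.const_mul |h 0|).add integrable_mul_rho.abs)
      (hh.continuous.mul continuous_rho).aestronglyMeasurable (ae_of_all _ fun u => ?_)
    rw [Real.norm_eq_abs, abs_mul, abs_of_pos (rho_pos u)]
    simp only [Pi.add_apply, abs_mul, abs_of_pos (rho_pos u)]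
    rw [← add_mul]
    exact mul_le_mul_of_nonneg_right (hbd u) (rho_pos u).le
  have hi : Integrable fun u => g u * rho u :=
    (hhr.sub (integrable_rho.const_mul m)).congr (ae_of_all _ fun u => by simp [hg, sub_mul])
  have h0 : ∫ u, g u * rho u = 0 := by
    have h1 : ∫ u, g u ∂(gaussianReal 0 1) = 0 := by
      simp only [hg]
      rw [integral_sub hhi (integrable_const _)]
      simp [hm]
    rw [integral_gaussianReal_eq_integral_smul (by norm_num)] at h1
    simp only [gaussianPDFReal_eq, smul_eq_mul, mul_assoc] at h1
    rw [integral_const_mul] at h1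
    have h2 : (√(2 * π))⁻¹ ≠ 0 := by positivity
    have := (mul_eq_zero.1 h1).resolve_left h2
    rw [← this]
    congr 1; ext u; ring
  have hgb : ∀ x, |g x| ≤ √(x ^ 2 + 1) := by
    intro x
    set s := √(x ^ 2 + 1) with hs
    have hs0 : 0 < s := by positivity
    have hs2 : s ^ 2 = x ^ 2 + 1 := sq_sqrt (by positivity)
    have e : g x = ∫ y, (h x - h y) ∂(gaussianReal 0 1) := by
      rw [integral_sub (integrable_const _) hhi]; simp [hg, hm]
    -- The integrand is `((x - y)² + s²) / (2s)`, which dominates `|x - y|` by the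
    -- arithmetic-geometric inequality. Its Gaussian mean is `s` because `E[(x - N)²] = x² + 1 =
    -- s²`.
    have i3 : Integrable (fun y => (x ^ 2 - 2 * x * y + y ^ 2 + s ^ 2) / (2 * s))
        (gaussianReal 0 1) :=
      ((((integrable_const _).sub (integrable_id_gaussian.const_mul (2 * x))).add
        integrable_sq_gaussian).add (integrable_const _)).div_const _
    rw [e]
    calc |∫ y, (h x - h y) ∂(gaussianReal 0 1)|
        ≤ ∫ y, |h x - h y| ∂(gaussianReal 0 1) := abs_integral_le_integral_abs
      _ ≤ ∫ y, (x ^ 2 - 2 * x * y + y ^ 2 + s ^ 2) / (2 * s) ∂(gaussianReal 0 1) := by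
          refine integral_mono ((integrable_const _).sub hhi).abs i3 fun y => ?_
          have := hh.dist_le_mul x y
          simp only [Real.dist_eq, NNReal.coe_one, one_mul] at this
          refine this.trans ?_
          rw [le_div_iff₀ (by positivity)]
          nlinarith [sq_nonneg (|x - y| - s), sq_abs (x - y)]
      _ = s := by
          rw [integral_div, integral_add, integral_add, integral_sub, integral_const_mul,
            integral_sq_gaussian]
          · simp only [integral_const, probReal_univ, smul_eq_mul, one_mul,
              integral_id_gaussianReal, mul_zero]
            rw [hs2]
            field_simp
            linarith
          · exact integrable_const _
          · exact integrable_id_gaussian.const_mul _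
          · exact (integrable_const _).sub (integrable_id_gaussian.const_mul _)
          · exact integrable_sq_gaussian
          · exact ((integrable_const _).sub (integrable_id_gaussian.const_mul _)).add
              integrable_sq_gaussian
          · exact integrable_const _
  have hd := hasDerivAt_sol hl.continuous hi
  refine ⟨sol g, fun x => x * sol g x + g x, hd, ?_, fun x => by ring,
    fun x => (sol_bounds hi h0 hl x).1, abs_deriv_sol_le hi h0 hl hgb,
    taylor_of_lipschitz_deriv hd (lipschitz_deriv_sol hi h0 hl)⟩
  have : Continuous (sol g) := continuous_iff_continuousAt.2 fun z => (hd z).continuousAt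
  exact (continuous_id.mul this).add hl.continuous

end

end Stein

/-! ### Blocks of the half-line and the uniform law. -/

noncomputable section

namespace UniformSeq

lemma unif_eq : unif = (2 : ℝ≥0∞)⁻¹ • volume.restrict (Set.Ico (-1 : ℝ) 1) := by
  unfold unif ProbabilityTheory.cond
  rw [Real.volume_Icc, restrict_Ico_eq_restrict_Icc]
  norm_num

lemma ae_unif : ∀ᵐ u ∂unif, u ∈ Set.Ico (-1 : ℝ) 1 := by
  rw [unif_eq]
  exact Measure.ae_smul_measure (ae_restrict_mem measurableSet_Ico) _

/-- The half-open block of index `k`. -/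
def blk (k : ℕ) : Set ℝ := Set.Ico (2 * (k : ℝ)) (2 * k + 2)

lemma measurableSet_blk (k : ℕ) : MeasurableSet (blk k) := measurableSet_Ico

lemma mem_blk_iff {k : ℕ} {t : ℝ} : t ∈ blk k ↔ 0 ≤ t ∧ ⌊t / 2⌋₊ = k := by
  unfold blk
  rw [Set.mem_Ico]
  constructor
  · rintro ⟨h1, h2⟩
    have : (0 : ℝ) ≤ k := by positivity
    refine ⟨by linarith, ?_⟩
    rw [Nat.floor_eq_iff (by linarith)]
    constructor <;> linarith
  · rintro ⟨h0, h⟩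
    rw [Nat.floor_eq_iff (by linarith)] at h
    constructor <;> linarith [h.1, h.2]

lemma disjoint_blk : Pairwise (Function.onFun Disjoint blk) := by
  intro i j hij
  refine Set.disjoint_left.2 fun t hi hj => hij ?_
  rw [← (mem_blk_iff.1 hi).2, (mem_blk_iff.1 hj).2]

lemma iUnion_blk : ⋃ k, blk k = Set.Ici (0 : ℝ) := by
  ext t
  simp [mem_blk_iff]

lemma add_mem_blk {u : ℝ} (hu : u ∈ Set.Ico (-1 : ℝ) 1) (k : ℕ) : 2 * (k : ℝ) + 1 + u ∈ blk k := by
  constructor <;> linarith [hu.1, hu.2]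

lemma measurableEmbedding_shift (k : ℕ) :
    MeasurableEmbedding fun u : ℝ => 2 * (k : ℝ) + 1 + u :=
  measurableEmbedding_addLeft _

lemma map_unif_shift (k : ℕ) :
    unif.map (fun u => 2 * (k : ℝ) + 1 + u) = (2 : ℝ≥0∞)⁻¹ • volume.restrict (blk k) := by
  have h := (measurePreserving_add_left (volume : Measure ℝ)
    (2 * (k : ℝ) + 1)).restrict_preimage (measurableSet_blk k)
  have e : (fun u : ℝ => 2 * (k : ℝ) + 1 + u) ⁻¹' blk k = Set.Ico (-1 : ℝ) 1 := by
    ext u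
    simp only [blk, Set.mem_preimage, Set.mem_Ico]
    constructor <;> rintro ⟨h1, h2⟩ <;> constructor <;> linarith
  rw [e] at h
  rw [unif_eq, Measure.map_smul, h.map_eq]

lemma restrict_blk (k : ℕ) :
    volume.restrict (blk k) = (2 : ℝ≥0∞) • unif.map (fun u => 2 * (k : ℝ) + 1 + u) := by
  rw [map_unif_shift, smul_smul, ENNReal.mul_inv_cancel (by simp) (by simp), one_smul]

lemma lintegral_blk (k : ℕ) (F : ℝ → ℝ≥0∞) :
    ∫⁻ t in blk k, F t = 2 * ∫⁻ u, F (2 * (k : ℝ) + 1 + u) ∂unif := by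
  rw [restrict_blk, lintegral_smul_measure, (measurableEmbedding_shift k).lintegral_map, smul_eq_mul]

lemma integral_blk (k : ℕ) (F : ℝ → ℝ) :
    ∫ t in blk k, F t = 2 * ∫ u, F (2 * (k : ℝ) + 1 + u) ∂unif := by
  rw [restrict_blk, integral_smul_measure, (measurableEmbedding_shift k).integral_map]
  simp

lemma lintegral_Ici (F : ℝ → ℝ≥0∞) :
    ∫⁻ t in Set.Ici (0 : ℝ), F t = ∑' k : ℕ, 2 * ∫⁻ u, F (2 * (k : ℝ) + 1 + u) ∂unif := by
  rw [← iUnion_blk, lintegral_iUnion measurableSet_blk disjoint_blk]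
  simp_rw [lintegral_blk]

lemma hasSum_integral_Ici {F : ℝ → ℝ} (hF : IntegrableOn F (Set.Ici 0)) :
    HasSum (fun k : ℕ => 2 * ∫ u, F (2 * (k : ℝ) + 1 + u) ∂unif) (∫ t in Set.Ici (0 : ℝ), F t) := by
  rw [← iUnion_blk] at hF ⊢
  have := hasSum_integral_iUnion measurableSet_blk disjoint_blk hF
  simpa only [integral_blk] using this

/-! ### Resampling one coordinate -/

/-- Joint measurability in the point and the new value is what allows Fubini's theorem when a
coordinate is resampled. -/
lemma measurable_update_prod (k : ℕ) :
    Measurable fun p : Ω × ℝ => Function.update p.1 k p.2 := by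
  refine measurable_pi_lambda _ fun j => ?_
  by_cases h : j = k
  · subst h; simpa using measurable_snd
  · simp only [Function.update_of_ne h]
    exact (measurable_pi_apply j).comp measurable_fst

/-- The coordinates are independent, so putting a fresh copy in place of one of them does not change
the law; it suffices to test this on cylinders. All the resampling identities rest on this fact. -/
lemma measurePreserving_update (k : ℕ) :
    MeasurePreserving (fun p : Ω × ℝ => Function.update p.1 k p.2) (P.prod unif) P := by
  refine ⟨measurable_update_prod k, ?_⟩
  refine Measure.eq_infinitePi _ fun s t ht => ?_
  have hpi : ∀ s : Finset ℕ, MeasurableSet (Set.pi (s : Set ℕ) t) := fun s =>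
    MeasurableSet.pi s.countable_toSet fun i _ => ht i
  rw [Measure.map_apply (measurable_update_prod k) (hpi s)]
  by_cases hk : k ∈ s
  · have e : (fun p : Ω × ℝ => Function.update p.1 k p.2) ⁻¹' Set.pi (s : Set ℕ) t
        = (Set.pi ((s.erase k : Finset ℕ) : Set ℕ) t) ×ˢ t k := by
      ext ⟨ω, u⟩
      simp only [Set.mem_preimage, Set.mem_pi, Finset.mem_coe, Set.mem_prod, Finset.mem_erase]
      constructor
      · intro h
        refine ⟨fun i hi => ?_, by simpa using h k hk⟩
        simpa [Function.update_of_ne hi.1] using h i hi.2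
      · rintro ⟨h1, h2⟩ i hi
        by_cases hik : i = k
        · subst hik; simpa using h2
        · simpa [Function.update_of_ne hik] using h1 i ⟨hik, hi⟩
    rw [e, Measure.prod_prod, P, Measure.infinitePi_pi _ (fun i _ => ht i),
      Finset.prod_erase_mul _ _ hk]
  · have e : (fun p : Ω × ℝ => Function.update p.1 k p.2) ⁻¹' Set.pi (s : Set ℕ) t
        = (Set.pi (s : Set ℕ) t) ×ˢ Set.univ := by
      ext ⟨ω, u⟩
      simp only [Set.mem_preimage, Set.mem_pi, Finset.mem_coe, Set.mem_prod, Set.mem_univ, and_true]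
      refine forall₂_congr fun i hi => ?_
      rw [Function.update_of_ne (by rintro rfl; exact hk hi)]
    rw [e, Measure.prod_prod, P, Measure.infinitePi_pi _ (fun i _ => ht i)]
    simp

lemma lintegral_resample (k : ℕ) {F : Ω → ℝ≥0∞} (hF : Measurable F) :
    ∫⁻ ω, (∫⁻ u, F (Function.update ω k u) ∂unif) ∂P = ∫⁻ ω, F ω ∂P := by
  rw [← (measurePreserving_update k).lintegral_comp hF, lintegral_prod]
  exact (hF.comp (measurable_update_prod k)).aemeasurable

lemma integrable_resample (k : ℕ) {F : Ω → ℝ} (hF : Integrable F P) :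
    Integrable (fun p : Ω × ℝ => F (Function.update p.1 k p.2)) (P.prod unif) :=
  (measurePreserving_update k).integrable_comp_of_integrable hF

lemma integral_resample (k : ℕ) {F : Ω → ℝ} (hF : Integrable F P) :
    ∫ ω, (∫ u, F (Function.update ω k u) ∂unif) ∂P = ∫ ω, F ω ∂P := by
  have h := integral_map (μ := P.prod unif) (measurable_update_prod k).aemeasurable (f := F)
    (by rw [(measurePreserving_update k).map_eq]; exact hF.aestronglyMeasurable)
  rw [(measurePreserving_update k).map_eq] at h
  rw [h, integral_prod _ (integrable_resample k hF)]

/-- The average over the coordinate `k`. -/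
def avg (k : ℕ) (x : Ω → ℝ) (ω : Ω) : ℝ := ∫ u, x (Function.update ω k u) ∂unif

/-- The part of `x` that is centered in the coordinate `k`. -/
def dif (k : ℕ) (x : Ω → ℝ) (ω : Ω) : ℝ := x ω - avg k x ω

lemma avg_update (k : ℕ) (x : Ω → ℝ) (ω : Ω) (v : ℝ) :
    avg k x (Function.update ω k v) = avg k x ω := by
  simp [avg]

lemma dif_update (k : ℕ) (x : Ω → ℝ) (ω : Ω) (v : ℝ) :
    dif k x (Function.update ω k v) = x (Function.update ω k v) - avg k x ω := by
  rw [dif, avg_update]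

lemma measurable_avg (k : ℕ) {x : Ω → ℝ} (hx : Measurable x) : Measurable (avg k x) :=
  ((hx.comp (measurable_update_prod k)).stronglyMeasurable.integral_prod_right'
    (ν := unif)).measurable

lemma measurable_dif (k : ℕ) {x : Ω → ℝ} (hx : Measurable x) : Measurable (dif k x) :=
  hx.sub (measurable_avg k hx)

lemma ae_memLp_resample (k : ℕ) {x : Ω → ℝ} (hm : Measurable x) (hx : MemLp x 2 P) :
    ∀ᵐ ω ∂P, MemLp (fun u => x (Function.update ω k u)) 2 unif := by
  have h1 : ∀ᵐ ω ∂P, ∫⁻ u, ‖x (Function.update ω k u)‖ₑ ^ 2 ∂unif < ∞ := by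
    refine ae_lt_top ?_ ?_
    · exact ((hm.enorm.pow_const 2).comp (measurable_update_prod k)).lintegral_prod_right'
    · rw [lintegral_resample k (F := fun ω => ‖x ω‖ₑ ^ 2) (hm.enorm.pow_const 2)]
      have := (eLpNorm_lt_top_iff_lintegral_rpow_enorm_lt_top (by simp) (by simp)).1 hx.2
      exact ne_of_lt (by simpa using this)
  filter_upwards [h1] with ω hω
  refine ⟨(hm.comp ((measurable_update_prod k).comp measurable_prodMk_left)).aestronglyMeasurable, ?_⟩
  refine (eLpNorm_lt_top_iff_lintegral_rpow_enorm_lt_top (by simp) (by simp)).2 ?_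
  simpa using hω

lemma ae_integral_dif_update (k : ℕ) {x : Ω → ℝ} (hm : Measurable x) (hx : MemLp x 2 P) :
    ∀ᵐ ω ∂P, ∫ u, dif k x (Function.update ω k u) ∂unif = 0 := by
  filter_upwards [ae_memLp_resample k hm hx] with ω hω
  simp_rw [dif_update]
  rw [integral_sub (hω.integrable (by norm_num)) (integrable_const _)]
  simp [avg]

lemma ae_memLp_dif_update (k : ℕ) {x : Ω → ℝ} (hm : Measurable x) (hx : MemLp x 2 P) :
    ∀ᵐ ω ∂P, MemLp (fun u => dif k x (Function.update ω k u)) 2 unif := by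
  filter_upwards [ae_memLp_resample k hm hx] with ω hω
  simp_rw [dif_update]
  exact hω.sub (memLp_const _)

/-- Averaging contracts the `L²` norm: on a probability space the `L¹` norm is at most the `L²`
norm, fibre by fibre. -/
lemma memLp_avg (k : ℕ) {x : Ω → ℝ} (hm : Measurable x) (hx : MemLp x 2 P) :
    MemLp (avg k x) 2 P := by
  refine ⟨(measurable_avg k hm).aestronglyMeasurable, ?_⟩
  refine (eLpNorm_lt_top_iff_lintegral_rpow_enorm_lt_top (by simp) (by simp)).2 ?_
  have hx2 := (eLpNorm_lt_top_iff_lintegral_rpow_enorm_lt_top (by simp) (by simp)).1 hx.2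
  simp only [ENNReal.toReal_ofNat, ENNReal.rpow_ofNat] at hx2 ⊢
  refine lt_of_le_of_lt ?_ hx2
  rw [← lintegral_resample k (F := fun ω => ‖x ω‖ₑ ^ 2) (hm.enorm.pow_const 2)]
  refine lintegral_mono fun ω => ?_
  have hms : AEStronglyMeasurable (fun u => x (Function.update ω k u)) unif :=
    (hm.comp ((measurable_update_prod k).comp measurable_prodMk_left)).aestronglyMeasurable
  have h1 : ‖avg k x ω‖ₑ ≤ ∫⁻ u, ‖x (Function.update ω k u)‖ₑ ∂unif :=
    enorm_integral_le_lintegral_enorm _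
  have h2 := eLpNorm_le_eLpNorm_of_exponent_le (p := 1) (q := 2) (by norm_num) hms
  rw [eLpNorm_one_eq_lintegral_enorm] at h2
  calc ‖avg k x ω‖ₑ ^ 2 ≤ (eLpNorm (fun u => x (Function.update ω k u)) 2 unif) ^ 2 := by
        gcongr; exact h1.trans h2
    _ = _ := by
        rw [eLpNorm_eq_lintegral_rpow_enorm_toReal (by simp) (by simp), ← ENNReal.rpow_natCast,
          ← ENNReal.rpow_mul]
        simp

lemma memLp_dif (k : ℕ) {x : Ω → ℝ} (hm : Measurable x) (hx : MemLp x 2 P) :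
    MemLp (dif k x) 2 P := hx.sub (memLp_avg k hm hx)

lemma block_shift (k : ℕ) {u : ℝ} (hu : u ∈ Set.Ico (-1 : ℝ) 1) :
    block (2 * (k : ℝ) + 1 + u) = blk k := by
  rw [block, (mem_blk_iff.1 (add_mem_blk hu k)).2, blk]

/-- The factor `1/2` in `nabla` turns Lebesgue measure on a block of length 2 into the uniform law.
This is the bridge between the continuous parameter `t` and the pairs formed by an index and a
uniform value. -/
lemma nabla_shift (k : ℕ) {u : ℝ} (hu : u ∈ Set.Ico (-1 : ℝ) 1) (x : Ω → ℝ) (ω : Ω) :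
    nabla (2 * (k : ℝ) + 1 + u) x ω = dif k x (Function.update ω k u) := by
  have hfl : ∀ v ∈ Set.Ico (-1 : ℝ) 1, Psi (2 * (k : ℝ) + 1 + v) ω = Function.update ω k v := by
    intro v hv
    have := (mem_blk_iff.1 (add_mem_blk hv k)).2
    rw [Psi, this]
    congr 1; ring
  rw [dif_update, nabla, hfl u hu, block_shift k hu, integral_blk]
  have : ∫ v, x (Psi (2 * (k : ℝ) + 1 + v) ω) ∂unif = avg k x ω := by
    refine integral_congr_ae ?_
    filter_upwards [ae_unif] with v hv
    rw [hfl v hv]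
  rw [this]; ring

lemma measurable_Psi : Measurable fun p : ℝ × Ω => Psi p.1 p.2 := by
  refine measurable_pi_lambda _ fun j => ?_
  have hfl : Measurable fun p : ℝ × Ω => ⌊p.1 / 2⌋₊ :=
    Nat.measurable_floor.comp (measurable_fst.div_const 2)
  simp only [Psi, Function.update_apply]
  refine Measurable.ite (measurableSet_eq_fun measurable_const hfl) ?_ ?_
  · exact (measurable_fst.sub ((measurable_from_nat.comp hfl).const_mul 2)).sub_const 1
  · exact (measurable_pi_apply j).comp measurable_snd

lemma measurable_nabla {x : Ω → ℝ} (hx : Measurable x) :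
    Measurable fun p : ℝ × Ω => nabla p.1 x p.2 := by
  have hfl : Measurable fun t : ℝ => 2 * (⌊t / 2⌋₊ : ℝ) :=
    ((measurable_from_nat (f := fun n : ℕ => (n : ℝ))).comp
      (Nat.measurable_floor.comp (measurable_id.div_const 2))).const_mul 2
  unfold nabla
  refine (hx.comp measurable_Psi).sub (Measurable.const_mul ?_ _)
  -- The domain of integration varies with `t`; an indicator on the product space moves this
  -- dependence into a jointly measurable integrand.
  have e : (fun p : ℝ × Ω => ∫ s in block p.1, x (Psi s p.2)) = fun p : ℝ × Ω =>
      ∫ s, Set.indicator {q : (ℝ × Ω) × ℝ | q.2 ∈ block q.1.1}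
        (fun q : (ℝ × Ω) × ℝ => x (Psi q.2 q.1.2)) (p, s) := by
    ext p
    rw [← integral_indicator (by unfold block; exact measurableSet_Ico)]
    rfl
  rw [e]
  refine (StronglyMeasurable.integral_prod_right (ν := volume) (Measurable.stronglyMeasurable ?_)).measurable
  refine Measurable.indicator ?_ ?_
  · exact hx.comp (measurable_Psi.comp (measurable_snd.prodMk (measurable_snd.comp measurable_fst)))
  · simp only [block, Set.mem_Ico]
    have h1 : Measurable fun q : (ℝ × Ω) × ℝ => 2 * (⌊q.1.1 / 2⌋₊ : ℝ) :=
      hfl.comp (measurable_fst.comp measurable_fst)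
    exact (measurableSet_le h1 measurable_snd).inter
      (measurableSet_lt measurable_snd (h1.add_const 2))

end UniformSeq

end

/-! ### Orthogonal sums of subspaces, and sums over finite sets of indices. -/

lemma inner_starProjection_self {E : Type*} [NormedAddCommGroup E]
    [InnerProductSpace ℝ E] (K : Submodule ℝ E) [CompleteSpace K] (y : E) :
    inner ℝ (K.starProjection y) y = ‖K.starProjection y‖ ^ 2 := by
  rw [← real_inner_self_eq_norm_sq, ← Submodule.inner_starProjection_left_eq_right,
    Submodule.starProjection_eq_self_iff.2 (Submodule.starProjection_apply_mem K y)]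

section HilbertSum

variable {E ι : Type*} [NormedAddCommGroup E] [InnerProductSpace ℝ E] [CompleteSpace E]
  {F : ι → Submodule ℝ E} [∀ i, CompleteSpace (F i)]

open scoped InnerProductSpace

lemma hasSum_starProjection_of_dense (ho : Pairwise fun i j => F i ⟂ F j)
    (hd : ⊤ ≤ (⨆ i, F i).topologicalClosure) (y : E) :
    HasSum (fun i => (F i).starProjection y) y := by
  classical
  have hof : OrthogonalFamily ℝ (fun i => F i) fun i => (F i).subtypeₗᵢ :=
    OrthogonalFamily.of_pairwise fun i j hij => ho hij
  have hs := IsHilbertSum.mkInternal F hof hd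
  have h := hs.hasSum_linearIsometryEquiv_symm (hs.linearIsometryEquiv y)
  rw [LinearIsometryEquiv.symm_apply_apply] at h
  set w := hs.linearIsometryEquiv y
  have e : ∀ i, (F i).starProjection y = (w i : E) := by
    intro i
    have h1 := h.mapL (F i).starProjection
    have h2 : HasSum (fun j => (F i).starProjection ((F j).subtypeₗᵢ (w j)))
        ((F i).starProjection ((F i).subtypeₗᵢ (w i))) := by
      refine hasSum_single i fun j hj => ?_
      rw [Submodule.starProjection_apply_eq_zero_iff]
      exact (ho hj).le (w j).2
    rw [h1.unique h2]
    exact Submodule.starProjection_eq_self_iff.2 (w i).2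
  simpa [e] using h

lemma hasSum_inner_starProjection_of_dense (ho : Pairwise fun i j => F i ⟂ F j)
    (hd : ⊤ ≤ (⨆ i, F i).topologicalClosure) (y z : E) :
    HasSum (fun i => ⟪(F i).starProjection y, z⟫_ℝ) ⟪y, z⟫_ℝ := by
  have := (hasSum_starProjection_of_dense ho hd y).mapL (innerSL ℝ z)
  simpa [real_inner_comm] using this

lemma hasSum_norm_sq_starProjection_of_dense (ho : Pairwise fun i j => F i ⟂ F j)
    (hd : ⊤ ≤ (⨆ i, F i).topologicalClosure) (y : E) :
    HasSum (fun i => ‖(F i).starProjection y‖ ^ 2) (‖y‖ ^ 2) := by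
  have := hasSum_inner_starProjection_of_dense ho hd y y
  simpa only [inner_starProjection_self, real_inner_self_eq_norm_sq] using this

end HilbertSum

lemma hasSum_ite_mem_finset {α : Type*} [DecidableEq α] (S : Finset α) (a : ℝ) :
    HasSum (fun k : α => if k ∈ S then a else 0) ((S.card : ℝ) * a) := by
  have : HasSum (fun k : α => if k ∈ S then a else 0) (∑ k ∈ S, if k ∈ S then a else 0) :=
    hasSum_sum_of_ne_finset_zero fun k hk => by simp [hk]
  simpa [Finset.sum_ite_mem] using this

lemma summable_ite_mem_of_card {c : Finset ℕ → ℝ}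
    (hc : Summable fun S : Finset ℕ => (S.card : ℝ) * |c S|) :
    Summable fun q : Finset ℕ × ℕ => if q.2 ∈ q.1 then c q.1 else 0 := by
  refine Summable.of_norm ?_
  have hn : ∀ q : Finset ℕ × ℕ, ‖(if q.2 ∈ q.1 then c q.1 else 0 : ℝ)‖
      = if q.2 ∈ q.1 then |c q.1| else 0 := fun q => by split_ifs <;> simp
  simp_rw [hn]
  rw [summable_prod_of_nonneg (fun q => by dsimp only; split_ifs <;> positivity)]
  exact ⟨fun S => (hasSum_ite_mem_finset S |c S|).summable,
    by simpa only [(hasSum_ite_mem_finset _ _).tsum_eq] using hc⟩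

/-- Exchange of the sums over `k` and over `S`: each `S` is counted once for every element. This is
how the number operator `|S|` appears. -/
lemma hasSum_of_hasSum_ite_mem {c : Finset ℕ → ℝ}
    (hc : Summable fun S : Finset ℕ => (S.card : ℝ) * |c S|) {d : ℕ → ℝ}
    (hd : ∀ k, HasSum (fun S : Finset ℕ => if k ∈ S then c S else 0) (d k)) :
    HasSum d (∑' S : Finset ℕ, (S.card : ℝ) * c S) := by
  have hs := summable_ite_mem_of_card hc
  have h1 := hs.hasSum.prod_fiberwise (fun S => hasSum_ite_mem_finset S (c S))
  have h2 := ((Equiv.prodComm ℕ (Finset ℕ)).hasSum_iff.2 hs.hasSum).prod_fiberwise (fun k => hd k)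
  rwa [h1.tsum_eq]

/-! ### The Hoeffding decomposition of `L²`. -/

noncomputable section

namespace UniformSeq

open scoped InnerProductSpace

/-- Bounded measurable functions that are centered for the uniform law. -/
structure IsFactor (g : ℝ → ℝ) : Prop where
  measurable : Measurable g
  bounded : ∃ C, ∀ u, |g u| ≤ C
  integral_eq : ∫ u, g u ∂unif = 0

/-- The product of the variables `g k (U_k)` over `k ∈ S`. -/
def prodFun (S : Finset ℕ) (g : ℕ → ℝ → ℝ) (ω : Ω) : ℝ := ∏ k ∈ S, g k (ω k)

lemma prodFun_update_of_mem {S : Finset ℕ} {k : ℕ} (hk : k ∈ S) (g : ℕ → ℝ → ℝ) (ω : Ω) (u : ℝ) :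
    prodFun S g (Function.update ω k u) = g k u * prodFun (S.erase k) g ω := by
  rw [prodFun, ← Finset.mul_prod_erase _ _ hk]
  simp only [Function.update_self]
  congr 1
  exact Finset.prod_congr rfl fun j hj => by rw [Function.update_of_ne (Finset.ne_of_mem_erase hj)]

lemma prodFun_update_of_notMem {S : Finset ℕ} {k : ℕ} (hk : k ∉ S) (g : ℕ → ℝ → ℝ) (ω : Ω) (u : ℝ) :
    prodFun S g (Function.update ω k u) = prodFun S g ω :=
  Finset.prod_congr rfl fun j hj => by rw [Function.update_of_ne (by rintro rfl; exact hk hj)]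

lemma measurable_prodFun (S : Finset ℕ) {g : ℕ → ℝ → ℝ} (hg : ∀ k, IsFactor (g k)) :
    Measurable (prodFun S g) :=
  Finset.measurable_fun_prod _ fun k _ => (hg k).measurable.comp (measurable_pi_apply k)

lemma bounded_prodFun (S : Finset ℕ) {g : ℕ → ℝ → ℝ} (hg : ∀ k, IsFactor (g k)) :
    ∃ C, ∀ ω, |prodFun S g ω| ≤ C := by
  choose C hC using fun k => (hg k).bounded
  refine ⟨∏ k ∈ S, C k, fun ω => ?_⟩
  rw [prodFun, Finset.abs_prod]
  exact Finset.prod_le_prod (fun k _ => abs_nonneg _) fun k _ => hC k _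

lemma memLp_prodFun (S : Finset ℕ) {g : ℕ → ℝ → ℝ} (hg : ∀ k, IsFactor (g k)) (p : ℝ≥0∞) :
    MemLp (prodFun S g) p P := by
  obtain ⟨C, hC⟩ := bounded_prodFun S hg
  exact MemLp.of_bound (measurable_prodFun S hg).aestronglyMeasurable C (ae_of_all _ hC)

lemma integrable_mul_prodFun (S : Finset ℕ) {g : ℕ → ℝ → ℝ} (hg : ∀ k, IsFactor (g k))
    {Y : Ω → ℝ} (hY : Integrable Y P) : Integrable (fun ω => Y ω * prodFun S g ω) P := by
  obtain ⟨C, hC⟩ := bounded_prodFun S hg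
  exact hY.mul_bdd (c := C) (measurable_prodFun S hg).aestronglyMeasurable (ae_of_all _ hC)

/-- A variable that factors through a centered function of one coordinate is centered. -/
lemma integral_eq_zero_of_factor (k : ℕ) {F R : Ω → ℝ} {g : ℝ → ℝ} (hF : Integrable F P)
    (hg : ∫ u, g u ∂unif = 0) (h : ∀ ω u, F (Function.update ω k u) = g u * R ω) :
    ∫ ω, F ω ∂P = 0 := by
  rw [← integral_resample k hF]
  simp_rw [h, integral_mul_const, hg]
  simp

lemma integral_prodFun_mul_prodFun {S T : Finset ℕ} (hST : ¬ S ⊆ T) {g g' : ℕ → ℝ → ℝ}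
    (hg : ∀ k, IsFactor (g k)) (hg' : ∀ k, IsFactor (g' k)) :
    ∫ ω, prodFun S g ω * prodFun T g' ω ∂P = 0 := by
  obtain ⟨k, hk, hk'⟩ := Finset.not_subset.1 hST
  refine integral_eq_zero_of_factor k (g := g k)
    (R := fun ω => prodFun (S.erase k) g ω * prodFun T g' ω)
    (integrable_mul_prodFun T hg' ((memLp_prodFun S hg 1).integrable le_rfl))
    (hg k).integral_eq fun ω u => ?_
  rw [prodFun_update_of_mem hk, prodFun_update_of_notMem hk', mul_assoc]

/-- If `k ∈ S`, the averaged part of `Y` does not depend on coordinate `k` and integrates to 0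
against the centered factor. If `k ∉ S`, the product is constant in coordinate `k`, so that `Y` and
its average have the same integral against it. -/
lemma integral_dif_mul_prodFun (k : ℕ) (S : Finset ℕ) {g : ℕ → ℝ → ℝ} (hg : ∀ k, IsFactor (g k))
    {Y : Ω → ℝ} (hm : Measurable Y) (hY : MemLp Y 2 P) :
    ∫ ω, dif k Y ω * prodFun S g ω ∂P = if k ∈ S then ∫ ω, Y ω * prodFun S g ω ∂P else 0 := by
  have hYi : Integrable Y P := hY.integrable (by norm_num)
  have hAi : Integrable (avg k Y) P := (memLp_avg k hm hY).integrable (by norm_num)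
  have e : ∫ ω, dif k Y ω * prodFun S g ω ∂P
      = ∫ ω, Y ω * prodFun S g ω ∂P - ∫ ω, avg k Y ω * prodFun S g ω ∂P := by
    rw [← integral_sub (integrable_mul_prodFun S hg hYi) (integrable_mul_prodFun S hg hAi)]
    simp [dif, sub_mul]
  rw [e]
  split_ifs with hk
  · rw [sub_eq_self]
    refine integral_eq_zero_of_factor k (g := g k)
      (R := fun ω => prodFun (S.erase k) g ω * avg k Y ω)
      (integrable_mul_prodFun S hg hAi) (hg k).integral_eq fun ω u => ?_
    rw [prodFun_update_of_mem hk, avg_update]; ring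
  · rw [sub_eq_zero, ← integral_resample k (integrable_mul_prodFun S hg hYi)]
    simp_rw [prodFun_update_of_notMem hk, integral_mul_const, avg]

/-- The generators of the Hoeffding space of `S`. -/
def hoeffGen (S : Finset ℕ) : Set (Lp ℝ 2 P) :=
  {Z | ∃ g, (∀ k, IsFactor (g k)) ∧ Z =ᵐ[P] prodFun S g}

/-- The Hoeffding space of `S`: the closed span of the products of centered functions of the
coordinates in `S`. -/
def hoeff (S : Finset ℕ) : Submodule ℝ (Lp ℝ 2 P) :=
  (Submodule.span ℝ (hoeffGen S)).topologicalClosure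

instance (S : Finset ℕ) : CompleteSpace (hoeff S) := by
  unfold hoeff; infer_instance

lemma inner_eq_integral (Y Z : Lp ℝ 2 P) : ⟪Y, Z⟫_ℝ = ∫ ω, Y ω * Z ω ∂P := by
  rw [L2.inner_def]
  simp [mul_comm]

lemma inner_eq_integral_of_ae (Y : Lp ℝ 2 P) {Z : Lp ℝ 2 P} {z : Ω → ℝ} (h : Z =ᵐ[P] z) :
    ⟪Y, Z⟫_ℝ = ∫ ω, Y ω * z ω ∂P := by
  rw [inner_eq_integral]
  refine integral_congr_ae ?_
  filter_upwards [h] with ω hω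
  rw [hω]

lemma mem_hoeff_orthogonal {S : Finset ℕ} {Y : Lp ℝ 2 P}
    (h : ∀ Z ∈ hoeffGen S, ⟪Z, Y⟫_ℝ = 0) : Y ∈ (hoeff S)ᗮ := by
  rw [hoeff, Submodule.orthogonal_closure, Submodule.mem_orthogonal]
  intro Z hZ
  induction hZ using Submodule.span_induction with
  | mem Z hZ => exact h Z hZ
  | zero => simp
  | add a b _ _ ha hb => rw [inner_add_left, ha, hb, add_zero]
  | smul c a _ ha => rw [inner_smul_left, ha, mul_zero]

lemma hoeffGen_subset (S : Finset ℕ) : hoeffGen S ⊆ hoeff S :=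
  Submodule.subset_span.trans (Submodule.le_topologicalClosure _)

lemma hoeff_isOrtho_of_gen {S : Finset ℕ} {K : Submodule ℝ (Lp ℝ 2 P)}
    (h : ∀ Z ∈ hoeffGen S, ∀ Y ∈ K, ⟪Z, Y⟫_ℝ = 0) : hoeff S ⟂ K := by
  rw [Submodule.isOrtho_comm, Submodule.isOrtho_iff_le]
  exact fun Y hY => mem_hoeff_orthogonal fun Z hZ => h Z hZ Y hY

lemma pairwise_hoeff_isOrtho : Pairwise fun S T => hoeff S ⟂ hoeff T := by
  have key : ∀ S T : Finset ℕ, S ≠ T → ∀ Z ∈ hoeffGen S, ∀ Y ∈ hoeffGen T, ⟪Z, Y⟫_ℝ = 0 := by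
    rintro S T hST Z ⟨g, hg, hZ⟩ Y ⟨g', hg', hY⟩
    have e : ⟪Z, Y⟫_ℝ = ∫ ω, prodFun S g ω * prodFun T g' ω ∂P := by
      rw [inner_eq_integral_of_ae _ hY]
      refine integral_congr_ae ?_
      filter_upwards [hZ] with ω hω
      rw [hω]
    rw [e]
    by_cases h : S ⊆ T
    · have h' : ¬ T ⊆ S := fun h' => hST (h.antisymm h')
      simp_rw [mul_comm (prodFun S g _)]
      exact integral_prodFun_mul_prodFun h' hg' hg
    · exact integral_prodFun_mul_prodFun h hg hg'
  intro S T hST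
  refine hoeff_isOrtho_of_gen fun Z hZ => ?_
  intro Y hY
  have : Z ∈ (hoeff T)ᗮ := mem_hoeff_orthogonal fun Y hY => by
    rw [real_inner_comm]; exact key S T hST Z hZ Y hY
  rw [real_inner_comm]
  exact Submodule.inner_right_of_mem_orthogonal hY this

lemma isFactor_indicator {A : Set ℝ} (hA : MeasurableSet A) :
    IsFactor fun u => A.indicator (fun _ => (1 : ℝ)) u - unif.real A := by
  refine ⟨(measurable_const.indicator hA).sub_const _, ⟨1 + |unif.real A|, fun u => ?_⟩, ?_⟩
  · refine (abs_sub _ _).trans (add_le_add_left ?_ _)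
    by_cases h : u ∈ A <;> simp [h]
  · rw [integral_sub ((integrable_const _).indicator hA) (integrable_const _)]
    simp [integral_indicator hA]

/-- The indicator of a box is the product of the `g k + unif.real (t k)` with `g k` a centered
indicator; expanding it gives a linear combination of products of centered functions. -/
lemma integral_eq_zero_box {Y : Ω → ℝ} (hY : Integrable Y P)
    (h : ∀ (S : Finset ℕ) (g : ℕ → ℝ → ℝ), (∀ k, IsFactor (g k)) →
      ∫ ω, Y ω * prodFun S g ω ∂P = 0)
    (s : Finset ℕ) {t : ℕ → Set ℝ} (ht : ∀ k, MeasurableSet (t k)) :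
    ∫ ω in Set.pi (s : Set ℕ) t, Y ω ∂P = 0 := by
  classical
  set g : ℕ → ℝ → ℝ := fun k u => (t k).indicator (fun _ => (1 : ℝ)) u - unif.real (t k)
  have hg : ∀ k, IsFactor (g k) := fun k => isFactor_indicator (ht k)
  have hpi : MeasurableSet (Set.pi (s : Set ℕ) t) :=
    MeasurableSet.pi s.countable_toSet fun i _ => ht i
  have e : ∀ ω, (Set.pi (s : Set ℕ) t).indicator Y ω
      = ∑ T ∈ s.powerset, (Y ω * prodFun T g ω) * ∏ k ∈ s \ T, unif.real (t k) := by
    intro ω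
    have e1 : (Set.pi (s : Set ℕ) t).indicator Y ω
        = Y ω * ∏ k ∈ s, (g k (ω k) + unif.real (t k)) := by
      simp only [g, sub_add_cancel]
      by_cases hω : ω ∈ Set.pi (s : Set ℕ) t
      · rw [Set.indicator_of_mem hω, Finset.prod_eq_one, mul_one]
        intro k hk
        exact Set.indicator_of_mem (hω k hk) _
      · rw [Set.indicator_of_notMem hω]
        simp only [Set.mem_pi, Finset.mem_coe, not_forall] at hω
        obtain ⟨k, hk, hk'⟩ := hω
        rw [Finset.prod_eq_zero hk (Set.indicator_of_notMem hk' _), mul_zero]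
    rw [e1, Finset.prod_add, Finset.mul_sum]
    simp [prodFun, mul_assoc]
  rw [← integral_indicator hpi]
  simp_rw [e]
  rw [integral_finsetSum _ fun T _ => (integrable_mul_prodFun T hg hY).mul_const _]
  refine Finset.sum_eq_zero fun T _ => ?_
  rw [integral_mul_const, h T g hg, zero_mul]

/-- Totality of the products. Integrals over boxes vanish, and boxes form a π-system generating the
σ-algebra, so integrals over all measurable sets vanish. -/
lemma ae_eq_zero_of_integral_mul_prodFun {Y : Ω → ℝ} (hY : Integrable Y P)
    (h : ∀ (S : Finset ℕ) (g : ℕ → ℝ → ℝ), (∀ k, IsFactor (g k)) →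
      ∫ ω, Y ω * prodFun S g ω ∂P = 0) : Y =ᵐ[P] 0 := by
  have h0 : ∫ ω, Y ω ∂P = 0 := by
    have := integral_eq_zero_box hY h ∅ (t := fun _ => Set.univ) (fun _ => MeasurableSet.univ)
    simpa using this
  refine hY.ae_eq_zero_of_forall_setIntegral_eq_zero fun A hA _ => ?_
  induction A, hA using MeasurableSpace.induction_on_inter
    (generateFrom_squareCylinders (α := fun _ : ℕ => ℝ)).symm
    (isPiSystem_squareCylinders (fun _ => MeasurableSpace.isPiSystem_measurableSet)
      (fun _ => by simp)) with
  | empty => simp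
  | basic A hA =>
    obtain ⟨s, t, ht, rfl⟩ := hA
    exact integral_eq_zero_box hY h s (fun k => ht k (Set.mem_univ k))
  | compl A hA ih =>
    rw [setIntegral_compl hA hY, h0, ih (measure_lt_top _ _), sub_zero]
  | iUnion f hd hf ih =>
    rw [integral_iUnion hf hd hY.integrableOn]
    simp [fun i => ih i (measure_lt_top _ _)]

lemma exists_mem_hoeffGen (S : Finset ℕ) {g : ℕ → ℝ → ℝ} (hg : ∀ k, IsFactor (g k)) :
    ∃ Z ∈ hoeffGen S, Z =ᵐ[P] prodFun S g :=
  ⟨(memLp_prodFun S hg 2).toLp, ⟨g, hg, MemLp.coeFn_toLp _⟩, MemLp.coeFn_toLp _⟩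

lemma dense_iSup_hoeff : ⊤ ≤ (⨆ S, hoeff S).topologicalClosure := by
  rw [top_le_iff, Submodule.topologicalClosure_eq_top_iff, eq_bot_iff]
  intro Y hY
  rw [Submodule.mem_bot]
  refine (Lp.eq_zero_iff_ae_eq_zero).2
    (ae_eq_zero_of_integral_mul_prodFun ((Lp.memLp Y).integrable (by norm_num)) fun S g hg => ?_)
  obtain ⟨Z, hZ, hZg⟩ := exists_mem_hoeffGen S hg
  rw [← inner_eq_integral_of_ae Y hZg, real_inner_comm]
  exact (Submodule.mem_orthogonal _ _).1 hY Z
    ((le_iSup hoeff S) (hoeffGen_subset S hZ))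

lemma starProjection_hoeff_eq {S : Finset ℕ} {A B : Lp ℝ 2 P}
    (h : ∀ Z ∈ hoeffGen S, ⟪A, Z⟫_ℝ = ⟪B, Z⟫_ℝ) :
    (hoeff S).starProjection A = (hoeff S).starProjection B := by
  rw [← sub_eq_zero, ← map_sub, Submodule.starProjection_apply_eq_zero_iff]
  refine mem_hoeff_orthogonal fun Z hZ => ?_
  rw [real_inner_comm, inner_sub_left, h Z hZ, sub_self]

/-- The operator `dif k` on `L²`. -/
def difLp (k : ℕ) (Y : Lp ℝ 2 P) : Lp ℝ 2 P :=
  (memLp_dif k (Lp.stronglyMeasurable Y).measurable (Lp.memLp Y)).toLp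

lemma coeFn_difLp (k : ℕ) (Y : Lp ℝ 2 P) : difLp k Y =ᵐ[P] dif k Y := MemLp.coeFn_toLp _

lemma starProjection_difLp (k : ℕ) (S : Finset ℕ) (Y : Lp ℝ 2 P) :
    (hoeff S).starProjection (difLp k Y) = if k ∈ S then (hoeff S).starProjection Y else 0 := by
  have key : ∀ Z ∈ hoeffGen S, ⟪difLp k Y, Z⟫_ℝ = if k ∈ S then ⟪Y, Z⟫_ℝ else 0 := by
    rintro Z ⟨g, hg, hZ⟩
    rw [inner_eq_integral_of_ae _ hZ, inner_eq_integral_of_ae _ hZ,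
      ← integral_dif_mul_prodFun k S hg (Lp.stronglyMeasurable Y).measurable (Lp.memLp Y)]
    refine integral_congr_ae ?_
    filter_upwards [coeFn_difLp k Y] with ω hω
    rw [hω]
  split_ifs with hk
  · exact starProjection_hoeff_eq fun Z hZ => by rw [key Z hZ, if_pos hk]
  · rw [← map_zero (hoeff S).starProjection]
    exact starProjection_hoeff_eq fun Z hZ => by rw [key Z hZ, if_neg hk, inner_zero_left]

end UniformSeq

end

noncomputable section

namespace UniformSeq

/-! ### Products of centered functions belong to the chaos -/

/-- The function `g`, transported to the block of index `k`. -/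
def onBlk (k : ℕ) (g : ℝ → ℝ) (t : ℝ) : ℝ := (blk k).indicator (fun t => g (t - 2 * k - 1)) t

lemma onBlk_of_notMem {k : ℕ} {t : ℝ} (ht : t ∉ blk k) (g : ℝ → ℝ) : onBlk k g t = 0 :=
  Set.indicator_of_notMem ht _

lemma onBlk_shift {u : ℝ} (hu : u ∈ Set.Ico (-1 : ℝ) 1) (g : ℝ → ℝ) (j k : ℕ) :
    onBlk j g (2 * (k : ℝ) + 1 + u) = if j = k then g u else 0 := by
  have h := add_mem_blk hu k
  split_ifs with hjk
  · subst hjk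
    rw [onBlk, Set.indicator_of_mem h]
    congr 1; ring
  · refine onBlk_of_notMem (fun h' => hjk ?_) g
    rw [← (mem_blk_iff.1 h).2, (mem_blk_iff.1 h').2]

lemma measurable_onBlk (k : ℕ) {g : ℝ → ℝ} (hg : Measurable g) : Measurable (onBlk k g) :=
  (hg.comp ((measurable_id.sub_const _).sub_const _)).indicator (measurableSet_blk k)

lemma abs_onBlk_le (k : ℕ) {g : ℝ → ℝ} {C : ℝ} (hC : ∀ u, |g u| ≤ C) (t : ℝ) :
    |onBlk k g t| ≤ C := by
  by_cases h : t ∈ blk k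
  · rw [onBlk, Set.indicator_of_mem h]; exact hC _
  · rw [onBlk_of_notMem h, abs_zero]; exact (abs_nonneg _).trans (hC 0)

lemma integrable_onBlk (k : ℕ) {g : ℝ → ℝ} (hm : Measurable g) (hb : ∃ C, ∀ u, |g u| ≤ C) :
    Integrable (onBlk k g) := by
  obtain ⟨C, hC⟩ := hb
  refine IntegrableOn.integrable_indicator ?_ (measurableSet_blk k)
  refine Measure.integrableOn_of_bounded (M := C) (by simp [blk])
    (hm.comp ((measurable_id.sub_const _).sub_const _)).aestronglyMeasurable
    (ae_of_all _ fun t => hC _)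

lemma onBlk_sq (k : ℕ) (g : ℝ → ℝ) (t : ℝ) : onBlk k g t ^ 2 = onBlk k (fun u => g u ^ 2) t := by
  unfold onBlk
  by_cases h : t ∈ blk k <;> simp [h]

lemma integral_onBlk (k : ℕ) {g : ℝ → ℝ} (hg : IsFactor g) : ∫ t, onBlk k g t = 0 := by
  unfold onBlk
  rw [integral_indicator (measurableSet_blk k), integral_blk]
  have : ∀ u, g (2 * (k : ℝ) + 1 + u - 2 * k - 1) = g u := fun u => by congr 1; ring
  simp [this, hg.integral_eq]

/-- The decomposition of `Fin n` into its first `r` and its last `n - r` elements. -/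
def splitEquiv {n r : ℕ} (h : r ≤ n) : Fin r ⊕ Fin (n - r) ≃ Fin n :=
  finSumFinEquiv.trans (finCongr (by omega))

/-- The concatenation of two vectors. -/
def join {n r : ℕ} (x : Fin r → ℝ) (y : Fin (n - r) → ℝ) : Fin n → ℝ :=
  fun i => if h : (i : ℕ) < r then x ⟨i, h⟩ else y ⟨i - r, by omega⟩

lemma join_inl {n r : ℕ} (h : r ≤ n) (x : Fin r → ℝ) (y : Fin (n - r) → ℝ) (i : Fin r) :
    join x y (splitEquiv h (Sum.inl i)) = x i := by
  simp [join, splitEquiv]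

lemma join_inr {n r : ℕ} (h : r ≤ n) (x : Fin r → ℝ) (y : Fin (n - r) → ℝ) (i : Fin (n - r)) :
    join x y (splitEquiv h (Sum.inr i)) = y i := by
  simp [join, splitEquiv]

lemma prod_join {n r : ℕ} (h : r ≤ n) (φ : Fin n → ℝ → ℝ) (x : Fin r → ℝ) (y : Fin (n - r) → ℝ) :
    ∏ i, φ i (join x y i) = (∏ i, φ (splitEquiv h (Sum.inl i)) (x i)) *
      ∏ i, φ (splitEquiv h (Sum.inr i)) (y i) := by
  rw [← (splitEquiv h).prod_comp, Fintype.prod_sum_type]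
  simp only [join_inl, join_inr]

/-- The points `2 k_i + 1 + U_{k_i}`. -/
def pt {r : ℕ} (k : Fin r → ℕ) (ω : Ω) : Fin r → ℝ := fun i => 2 * (k i : ℝ) + 1 + ω (k i)

lemma mixedPoint_eq {n r : ℕ} (ω : Ω) (k : Fin r → ℕ) (y : Fin (n - r) → ℝ) :
    (mixedPoint ω k y : Fin n → ℝ) = join (pt k ω) y := rfl

lemma ae_mem_Ico : ∀ᵐ ω ∂P, ∀ k : ℕ, ω k ∈ Set.Ico (-1 : ℝ) 1 := by
  rw [ae_all_iff]
  intro k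
  exact (measurePreserving_eval_infinitePi (fun _ : ℕ => unif) k).quasiMeasurePreserving.ae ae_unif

/-- The symmetrised tensor product of the functions `g (j i)`, transported to their blocks. -/
def symKernel {n : ℕ} (j : Fin n → ℕ) (g : ℕ → ℝ → ℝ) (x : Fin n → ℝ) : ℝ :=
  ∑ σ : Equiv.Perm (Fin n), ∏ i, onBlk (j (σ i)) (g (j (σ i))) (x i)

section

variable {n : ℕ} {j : Fin n → ℕ} {g : ℕ → ℝ → ℝ}

lemma isKernel_symKernel (hj : Function.Injective j) (hg : ∀ k, IsFactor (g k)) :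
    IsKernel n (symKernel j g) := by
  have hinteg : ∀ σ : Equiv.Perm (Fin n), Integrable fun x : Fin n → ℝ =>
      ∏ i, onBlk (j (σ i)) (g (j (σ i))) (x i) := fun σ =>
    Integrable.fintype_prod fun i => integrable_onBlk _ (hg _).measurable (hg _).bounded
  refine ⟨fun τ x => ?_, fun x hx => ?_, integrable_finsetSum _ fun σ _ => hinteg σ,
    memLp_finsetSum _ fun σ _ => ?_⟩
  · refine Fintype.sum_equiv (Equiv.mulRight τ⁻¹) _ _ fun σ => ?_
    refine Fintype.prod_equiv τ _ _ fun i => ?_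
    simp
  · refine Finset.sum_eq_zero fun σ _ => ?_
    by_contra h
    rw [Finset.prod_eq_zero_iff] at h
    push Not at h
    refine hx (Set.mem_iUnion.2 ⟨⟨fun i => j (σ i), hj.comp σ.injective⟩, fun i _ => ?_⟩)
    have : x i ∈ blk (j (σ i)) := by
      by_contra h'
      exact h i (Finset.mem_univ i) (onBlk_of_notMem h' _)
    exact ⟨this.1, this.2.le⟩
  · rw [memLp_two_iff_integrable_sq (hinteg σ).aestronglyMeasurable]
    simp_rw [← Finset.prod_pow, onBlk_sq]
    refine Integrable.fintype_prod fun i =>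
      integrable_onBlk _ ((hg _).measurable.pow_const 2) ?_
    obtain ⟨C, hC⟩ := (hg (j (σ i))).bounded
    refine ⟨C ^ 2, fun u => ?_⟩
    rw [abs_pow]
    exact pow_le_pow_left₀ (abs_nonneg _) (hC u) 2

/-- Integrating out even one variable gives zero, because every factor is centered. -/
lemma integral_symKernel (hg : ∀ k, IsFactor (g k)) {r : ℕ} (hr : r ≤ n) (x : Fin r → ℝ) :
    ∫ y : Fin (n - r) → ℝ, symKernel j g (join x y) = ∑ σ : Equiv.Perm (Fin n),
      if r = n then ∏ i : Fin r, onBlk (j (σ (splitEquiv hr (Sum.inl i))))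
        (g (j (σ (splitEquiv hr (Sum.inl i))))) (x i) else 0 := by
  simp only [symKernel]
  simp_rw [fun σ : Equiv.Perm (Fin n) => prod_join hr (fun i => onBlk (j (σ i)) (g (j (σ i)))) x]
  rw [integral_finsetSum]
  · refine Finset.sum_congr rfl fun σ _ => ?_
    rw [integral_const_mul, integral_fintype_prod_volume_eq_prod
      (fun i => onBlk (j (σ (splitEquiv hr (Sum.inr i)))) (g (j (σ (splitEquiv hr (Sum.inr i))))))]
    simp_rw [integral_onBlk _ (hg _)]
    split_ifs with h
    · have : IsEmpty (Fin (n - r)) := by rw [h, Nat.sub_self]; infer_instance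
      simp
    · have : Nonempty (Fin (n - r)) := ⟨⟨0, by omega⟩⟩
      simp [Finset.prod_const]
      right; omega
  · intro σ _
    exact (Integrable.fintype_prod fun i =>
      integrable_onBlk _ (hg _).measurable (hg _).bounded).const_mul _

/-- Only `r = n` survives, and among the tuples of indices only the permutations of `j` meet the
support; each of the `n!` permutations contributes the same product. -/
lemma multInt_symKernel (hj : Function.Injective j) (hg : ∀ k, IsFactor (g k)) :
    multInt n (symKernel j g) =ᵐ[P] fun ω => (n.factorial : ℝ) * ∏ i, g (j i) (ω (j i)) := by
  filter_upwards [ae_mem_Ico] with ω hω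
  unfold multInt
  simp_rw [mixedPoint_eq]
  rw [Finset.sum_eq_single n]
  · have e : ∀ k : Fin n ↪ ℕ, ∫ y : Fin (n - n) → ℝ, symKernel j g (join (pt k ω) y) =
        ∑ σ : Equiv.Perm (Fin n), if k = fun i => j (σ i) then
          ∏ i, g (j (σ i)) (ω (j (σ i))) else 0 := by
      intro k
      rw [integral_symKernel hg le_rfl]
      refine Finset.sum_congr rfl fun σ _ => ?_
      rw [if_pos rfl]
      have hs : ∀ i : Fin n, splitEquiv le_rfl (Sum.inl i) = i := fun i => by
        ext; simp [splitEquiv]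
      simp only [hs, pt]
      simp_rw [fun i => onBlk_shift (hω (k i)) (g (j (σ i))) (j (σ i)) (k i)]
      split_ifs with h
      · refine Finset.prod_congr rfl fun i _ => ?_
        have := congrFun h i
        rw [if_pos this.symm, this]
      · obtain ⟨i, hi⟩ := Function.ne_iff.1 h
        exact Finset.prod_eq_zero (Finset.mem_univ i) (if_neg (Ne.symm hi))
    simp_rw [e]
    have hs : HasSum (fun k : Fin n ↪ ℕ => ∑ σ : Equiv.Perm (Fin n), if k = fun i => j (σ i) then
          ∏ i, g (j (σ i)) (ω (j (σ i))) else 0)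
        (∑ σ : Equiv.Perm (Fin n), ∏ i, g (j (σ i)) (ω (j (σ i)))) := by
      refine hasSum_sum fun σ _ => ?_
      have := hasSum_single (f := fun k : Fin n ↪ ℕ => if (k : Fin n → ℕ) = fun i => j (σ i) then
          ∏ i, g (j (σ i)) (ω (j (σ i))) else 0) ⟨fun i => j (σ i), hj.comp σ.injective⟩
        (fun k hk => if_neg fun h => hk (DFunLike.ext' h))
      simpa using this
    rw [hs.tsum_eq]
    have : ∀ σ : Equiv.Perm (Fin n), ∏ i, g (j (σ i)) (ω (j (σ i))) = ∏ i, g (j i) (ω (j i)) :=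
      fun σ => Equiv.prod_comp σ fun i => g (j i) (ω (j i))
    simp [this, Fintype.card_perm]
  · intro r hr hrn
    have hr' : r ≤ n := by rw [Finset.mem_range] at hr; omega
    simp_rw [integral_symKernel hg hr']
    simp [hrn]
  · simp

end

lemma hoeff_le_chaos (S : Finset ℕ) : hoeff S ≤ chaos S.card := by
  have hc : IsClosed (chaos S.card : Set (Lp ℝ 2 P)) := Submodule.isClosed_topologicalClosure _
  refine Submodule.topologicalClosure_minimal _ (Submodule.span_le.2 ?_) hc
  rintro Z ⟨g, hg, hZ⟩
  set j := S.orderEmbOfFin rfl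
  have h1 : ((S.card.factorial : ℝ) • Z) ∈ chaos S.card := by
    refine Submodule.le_topologicalClosure _ (Submodule.subset_span
      ⟨symKernel j g, isKernel_symKernel j.injective hg, ?_⟩)
    filter_upwards [multInt_symKernel (j := j) j.injective hg, hZ,
      Lp.coeFn_smul (S.card.factorial : ℝ) Z] with ω h1 h2 h3
    rw [h1, h3, Pi.smul_apply, h2, smul_eq_mul, prodFun]
    congr 1
    conv_lhs => rw [← Finset.image_orderEmbOfFin_univ S rfl]
    rw [Finset.prod_image fun a _ b _ h => j.injective h]
  have h2 := (chaos S.card).smul_mem (S.card.factorial : ℝ)⁻¹ h1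
  rwa [smul_smul, inv_mul_cancel₀ (by positivity), one_smul] at h2

end UniformSeq

end

lemma integrable_tsum_of_summable_integral_norm {α ι : Type*} [MeasurableSpace α] [Countable ι]
    {μ : Measure α} {F : ι → α → ℝ} (hF : ∀ i, Integrable (F i) μ)
    (hs : Summable fun i => ∫ a, ‖F i a‖ ∂μ) : Integrable (fun a => ∑' i, F i a) μ := by
  refine ⟨(AEMeasurable.tsum fun i => (hF i).aemeasurable).aestronglyMeasurable, ?_⟩
  calc ∫⁻ a, ‖∑' i, F i a‖ₑ ∂μ ≤ ∫⁻ a, ∑' i, ‖F i a‖ₑ ∂μ :=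
        lintegral_mono fun a => enorm_tsum_le_tsum_enorm
    _ = ∑' i, ENNReal.ofReal (∫ a, ‖F i a‖ ∂μ) := by
        rw [lintegral_tsum fun i => (hF i).aestronglyMeasurable.enorm]
        simp_rw [fun i => ofReal_integral_norm_eq_lintegral_enorm (hF i)]
    _ < ∞ := hs.tsum_ofReal_lt_top

/-- Up to the factor `s!`, this is the `n`-th finite difference at 0 of `r ↦ choose r s`, which is
nonzero only for `s = n`. -/
lemma sum_neg_one_pow_choose_descFactorial {n s : ℕ} (h : s ≠ n) :
    ∑ r ∈ Finset.range (n + 1), (-1 : ℝ) ^ (n - r) * (n.choose r : ℝ) * (r.descFactorial s : ℝ)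
      = 0 := by
  have h1 := fwdDiff_iter_choose_zero s n
  rw [fwdDiff_iter_eq_sum_shift, if_neg (Ne.symm h)] at h1
  have h2 := congrArg (fun z : ℤ => (s.factorial : ℝ) * (z : ℝ)) h1
  simp only [smul_eq_mul, zero_add, mul_one, Int.cast_zero, mul_zero, Int.cast_sum,
    Finset.mul_sum] at h2
  rw [← h2]
  refine Finset.sum_congr rfl fun r _ => ?_
  rw [Nat.descFactorial_eq_factorial_mul_choose]
  push_cast
  ring

noncomputable section

namespace UniformSeq

/-! ### Products of centered functions are orthogonal to the other chaoses -/

lemma measurable_join {n r : ℕ} :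
    Measurable fun p : (Fin r → ℝ) × (Fin (n - r) → ℝ) => (join p.1 p.2 : Fin n → ℝ) := by
  refine measurable_pi_lambda _ fun i => ?_
  unfold join
  split_ifs with h
  · exact (measurable_pi_apply _).comp measurable_fst
  · exact (measurable_pi_apply _).comp measurable_snd

lemma measurePreserving_join {n r : ℕ} (hr : r ≤ n) :
    MeasurePreserving (fun p : (Fin r → ℝ) × (Fin (n - r) → ℝ) => (join p.1 p.2 : Fin n → ℝ))
      (volume.prod volume) volume := by
  refine ⟨measurable_join, (Measure.pi_eq fun s hs => ?_).symm⟩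
  rw [Measure.map_apply measurable_join (MeasurableSet.univ_pi hs)]
  have e : (fun p : (Fin r → ℝ) × (Fin (n - r) → ℝ) => (join p.1 p.2 : Fin n → ℝ)) ⁻¹'
      (Set.univ.pi s) = (Set.univ.pi fun i => s (splitEquiv hr (Sum.inl i))) ×ˢ
        (Set.univ.pi fun i => s (splitEquiv hr (Sum.inr i))) := by
    ext ⟨x, y⟩
    simp only [Set.mem_preimage, Set.mem_prod, Set.mem_univ_pi]
    rw [← (splitEquiv hr).forall_congr_right, Sum.forall]
    simp only [join_inl, join_inr]
  rw [e, Measure.prod_prod, volume_pi_pi, volume_pi_pi, ← (splitEquiv hr).prod_comp,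
    Fintype.prod_sum_type]

/-- The box of half-open blocks of indices `k i`. -/
def box {r : ℕ} (k : Fin r → ℕ) : Set (Fin r → ℝ) := Set.univ.pi fun i => blk (k i)

lemma measurableSet_box {r : ℕ} (k : Fin r → ℕ) : MeasurableSet (box k) :=
  MeasurableSet.univ_pi fun _ => measurableSet_blk _

lemma measurable_pt {r : ℕ} (k : Fin r → ℕ) : Measurable (pt k) :=
  measurable_pi_lambda _ fun i => (measurable_pi_apply (k i)).const_add _

lemma map_pt {r : ℕ} (k : Fin r ↪ ℕ) :
    P.map (pt k) = ((2 : ℝ≥0∞)⁻¹ ^ r) • volume.restrict (box k) := by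
  have h1 : P.map (fun ω (i : Fin r) => ω (k i)) = Measure.pi fun _ : Fin r => unif := by
    rw [P, Measure.map_infinitePi_infinitePi_of_inj k.injective, Measure.infinitePi_eq_pi]
  have h2 : P.map (pt k) = (P.map (fun ω (i : Fin r) => ω (k i))).map
      (fun x i => 2 * (k i : ℝ) + 1 + x i) := by
    refine (Measure.map_map (g := fun (x : Fin r → ℝ) i => 2 * (k i : ℝ) + 1 + x i)
      (f := fun (ω : Ω) i => ω (k i)) ?_ ?_).symm
    · exact measurable_pi_lambda _ fun i => (measurable_pi_apply i).const_add _
    · exact measurable_pi_lambda _ fun i => measurable_pi_apply _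
  rw [h2, h1]
  have hprob : ∀ i, IsProbabilityMeasure (unif.map fun u => 2 * (k i : ℝ) + 1 + u) := fun i =>
    Measure.isProbabilityMeasure_map (measurableEmbedding_shift (k i)).measurable.aemeasurable
  rw [Measure.pi_map_pi (f := fun i u => 2 * (k i : ℝ) + 1 + u)
    fun i => (measurableEmbedding_shift (k i)).measurable.aemeasurable]
  refine Measure.pi_eq fun s hs => ?_
  rw [Measure.smul_apply, Measure.restrict_apply (MeasurableSet.univ_pi hs), box,
    ← Set.pi_inter_distrib, volume_pi_pi]
  simp_rw [map_unif_shift, Measure.smul_apply, smul_eq_mul, Finset.prod_mul_distrib,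
    Finset.prod_const, Finset.card_univ, Fintype.card_fin, Measure.restrict_apply (hs _)]

lemma integral_comp_pt {r : ℕ} (k : Fin r ↪ ℕ) {F : (Fin r → ℝ) → ℝ}
    (hF : AEStronglyMeasurable F) :
    ∫ ω, F (pt k ω) ∂P = (2⁻¹ : ℝ) ^ r * ∫ x in box k, F x := by
  have h := integral_map (μ := P) (measurable_pt k).aemeasurable (f := F)
    (by rw [map_pt]; exact hF.restrict.smul_measure _)
  rw [← h, map_pt, integral_smul_measure]
  simp

lemma integrable_comp_pt {r : ℕ} (k : Fin r ↪ ℕ) {F : (Fin r → ℝ) → ℝ}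
    (hF : Integrable F) : Integrable (fun ω => F (pt k ω)) P := by
  have h : Integrable F (P.map (pt k)) := by
    rw [map_pt]
    exact hF.restrict.smul_measure (by simp)
  exact h.comp_measurable (measurable_pt k)

/-- The product over `j ∈ S` of the sums of the values of `g j` at the points in the block `j`. -/
def blockProd (S : Finset ℕ) (g : ℕ → ℝ → ℝ) {r : ℕ} (x : Fin r → ℝ) : ℝ :=
  ∏ j ∈ S, ∑ i, onBlk j (g j) (x i)

section

variable {S : Finset ℕ} {g : ℕ → ℝ → ℝ}

lemma measurable_blockProd (hg : ∀ k, IsFactor (g k)) {r : ℕ} :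
    Measurable (blockProd S g (r := r)) :=
  Finset.measurable_fun_prod _ fun j _ => Finset.measurable_fun_sum _ fun i _ =>
    (measurable_onBlk j (hg j).measurable).comp (measurable_pi_apply i)

lemma bounded_blockProd (hg : ∀ k, IsFactor (g k)) {r : ℕ} :
    ∃ C, ∀ x : Fin r → ℝ, |blockProd S g x| ≤ C := by
  choose C hC using fun k => (hg k).bounded
  refine ⟨∏ j ∈ S, ∑ _i : Fin r, C j, fun x => ?_⟩
  rw [blockProd, Finset.abs_prod]
  refine Finset.prod_le_prod (fun k _ => abs_nonneg _) fun j _ => ?_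
  exact (Finset.abs_sum_le_sum_abs _ _).trans
    (Finset.sum_le_sum fun i _ => abs_onBlk_le j (hC j) _)

lemma integrable_mul_blockProd (hg : ∀ k, IsFactor (g k)) {r : ℕ} {F : (Fin r → ℝ) → ℝ}
    (hF : Integrable F) : Integrable fun x => F x * blockProd S g x := by
  obtain ⟨C, hC⟩ := bounded_blockProd (S := S) hg (r := r)
  exact hF.mul_bdd (c := C) (measurable_blockProd hg).aestronglyMeasurable (ae_of_all _ hC)

lemma blockProd_pt {r : ℕ} (k : Fin r ↪ ℕ) {ω : Ω} (hω : ∀ k : ℕ, ω k ∈ Set.Ico (-1 : ℝ) 1) :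
    blockProd S g (pt k ω) = ∏ j ∈ S, ∑ i, if j = k i then g j (ω (k i)) else 0 := by
  simp only [blockProd, pt]
  simp_rw [fun i j => onBlk_shift (hω (k i)) (g j) j (k i)]

/-- If the indices `k` cover `S`, then `blockProd` at the random points is almost surely the product
itself. If some `j ∈ S` is missed, both sides vanish: on the left by centering in coordinate `j`, on
the right because no point falls in block `j`. -/
lemma integral_comp_pt_mul_prodFun (hg : ∀ k, IsFactor (g k)) {r : ℕ} (k : Fin r ↪ ℕ)
    {F : (Fin r → ℝ) → ℝ} (hF : Integrable F) :
    ∫ ω, F (pt k ω) * prodFun S g ω ∂P = (2⁻¹ : ℝ) ^ r * ∫ x in box k, F x * blockProd S g x := by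
  rw [← integral_comp_pt k (F := fun x => F x * blockProd S g x)
    (integrable_mul_blockProd hg hF).aestronglyMeasurable]
  by_cases hS : ∀ j ∈ S, ∃ i, k i = j
  · refine integral_congr_ae ?_
    filter_upwards [ae_mem_Ico] with ω hω
    rw [blockProd_pt k hω, prodFun]
    congr 1
    refine Finset.prod_congr rfl fun j hj => ?_
    obtain ⟨i, rfl⟩ := hS j hj
    rw [Finset.sum_eq_single i]
    · simp
    · intro i' _ hi'
      rw [if_neg fun h => hi' (k.injective h.symm)]
    · simp
  · push Not at hS
    obtain ⟨j, hj, hk⟩ := hS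
    have h1 : ∫ ω, F (pt k ω) * blockProd S g (pt k ω) ∂P = 0 := by
      refine integral_eq_zero_of_ae ?_
      filter_upwards [ae_mem_Ico] with ω hω
      rw [blockProd_pt k hω, Finset.prod_eq_zero hj, mul_zero, Pi.zero_apply]
      exact Finset.sum_eq_zero fun i _ => if_neg fun h => hk i h.symm
    rw [h1]
    refine integral_eq_zero_of_factor j (g := g j)
      (R := fun ω => F (pt k ω) * prodFun (S.erase j) g ω)
      (integrable_mul_prodFun S hg (integrable_comp_pt k hF)) (hg j).integral_eq fun ω u => ?_
    have : pt k (Function.update ω j u) = pt k ω := by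
      ext i
      simp only [pt, Function.update_of_ne (hk i)]
    rw [this, prodFun_update_of_mem hj]; ring

end

lemma disjoint_box {r : ℕ} :
    Pairwise (Function.onFun Disjoint fun k : Fin r ↪ ℕ => box k) := by
  intro k k' hkk
  refine Set.disjoint_left.2 fun x hx hx' => hkk ?_
  ext i
  rw [← (mem_blk_iff.1 (hx i trivial)).2, (mem_blk_iff.1 (hx' i trivial)).2]

lemma countable_embedding_nat (r : ℕ) : Countable (Fin r ↪ ℕ) :=
  DFunLike.coe_injective.countable

/-- The integral of `f` over its last variables. -/
def partInt {n : ℕ} (f : (Fin n → ℝ) → ℝ) (r : ℕ) (x : Fin r → ℝ) : ℝ :=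
  ∫ y : Fin (n - r) → ℝ, f (join x y)

section

variable {n : ℕ} {f : (Fin n → ℝ) → ℝ}

lemma integrable_join (hf : Integrable f) {r : ℕ} (hr : r ≤ n) :
    Integrable (fun p : (Fin r → ℝ) × (Fin (n - r) → ℝ) => f (join p.1 p.2))
      (volume.prod volume) :=
  (measurePreserving_join hr).integrable_comp_of_integrable hf

lemma integrable_partInt (hf : Integrable f) {r : ℕ} (hr : r ≤ n) :
    Integrable (partInt f r) := (integrable_join hf hr).integral_prod_left

/-- `Delta` consists of closed boxes and `box` of half-open ones; they differ by points having a
coordinate at a right endpoint, a null set. -/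
lemma ae_partInt_eq_zero (hf : IsKernel n f) {r : ℕ} (hr : r ≤ n) :
    ∀ᵐ x : Fin r → ℝ, x ∉ ⋃ k : Fin r ↪ ℕ, box k → partInt f r x = 0 := by
  have h : ∀ᵐ x : Fin r → ℝ, ∀ (i : Fin r) (m : ℕ), x i ≠ 2 * (m : ℝ) + 2 := by
    rw [ae_all_iff]
    intro i
    rw [ae_all_iff]
    intro m
    exact Measure.ae_eval_ne _ i _
  filter_upwards [h] with x hx hxb
  unfold partInt
  have : ∀ y : Fin (n - r) → ℝ, f (join x y) = 0 := by
    intro y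
    refine hf.zero_off _ fun hD => hxb ?_
    obtain ⟨K, hK⟩ := Set.mem_iUnion.1 hD
    refine Set.mem_iUnion.2 ⟨⟨fun i => K (splitEquiv hr (Sum.inl i)), fun a b hab => ?_⟩,
      fun i _ => ?_⟩
    · exact Sum.inl_injective ((splitEquiv hr).injective (K.injective hab))
    · have := hK (splitEquiv hr (Sum.inl i)) trivial
      simp only [join_inl] at this
      exact ⟨this.1, lt_of_le_of_ne this.2 (hx i _)⟩
  simp [this]

lemma setIntegral_iUnion_box (hf : IsKernel n f) {r : ℕ} (hr : r ≤ n) {G : (Fin r → ℝ) → ℝ}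
    (hG : ∀ x, partInt f r x = 0 → G x = 0) :
    ∫ x in ⋃ k : Fin r ↪ ℕ, box k, G x = ∫ x, G x := by
  have := countable_embedding_nat r
  refine setIntegral_eq_integral_of_ae_compl_eq_zero ?_
  filter_upwards [ae_partInt_eq_zero hf hr] with x hx hxb
  exact hG x (hx hxb)

lemma hasSum_box {r : ℕ} {G : (Fin r → ℝ) → ℝ} (hG : Integrable G) :
    HasSum (fun k : Fin r ↪ ℕ => ∫ x in box k, G x) (∫ x in ⋃ k : Fin r ↪ ℕ, box k, G x) := by
  have := countable_embedding_nat r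
  exact hasSum_integral_iUnion (fun k => measurableSet_box _) disjoint_box hG.integrableOn

variable {S : Finset ℕ} {g : ℕ → ℝ → ℝ}

lemma summable_integral_norm (hf : IsKernel n f) (hg : ∀ k, IsFactor (g k)) {r : ℕ} (hr : r ≤ n) :
    Summable fun k : Fin r ↪ ℕ => ∫ ω, ‖partInt f r (pt k ω) * prodFun S g ω‖ ∂P := by
  obtain ⟨C, hC⟩ := bounded_prodFun S hg
  have hi := integrable_partInt hf.integrable hr
  refine Summable.of_nonneg_of_le (fun k => integral_nonneg fun ω => norm_nonneg _) (fun k => ?_)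
    (((hasSum_box hi.norm).summable.mul_left ((2⁻¹ : ℝ) ^ r)).mul_right C)
  rw [← integral_comp_pt k hi.norm.aestronglyMeasurable, ← integral_mul_const]
  refine integral_mono (integrable_mul_prodFun S hg (integrable_comp_pt k hi)).norm
    ((integrable_comp_pt k hi.norm).mul_const C) fun ω => ?_
  dsimp only
  rw [norm_mul]
  exact mul_le_mul_of_nonneg_left (hC ω) (norm_nonneg _)

lemma integral_tsum_mul_prodFun (hf : IsKernel n f) (hg : ∀ k, IsFactor (g k)) {r : ℕ}
    (hr : r ≤ n) :
    Integrable (fun ω => (∑' k : Fin r ↪ ℕ, partInt f r (pt k ω)) * prodFun S g ω) P ∧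
    ∫ ω, (∑' k : Fin r ↪ ℕ, partInt f r (pt k ω)) * prodFun S g ω ∂P
      = (2⁻¹ : ℝ) ^ r * ∫ x : Fin r → ℝ, partInt f r x * blockProd S g x := by
  have := countable_embedding_nat r
  have hi := integrable_partInt hf.integrable hr
  have hs := summable_integral_norm (S := S) hf hg hr
  have hinteg : ∀ k : Fin r ↪ ℕ, Integrable (fun ω => partInt f r (pt k ω) * prodFun S g ω) P :=
    fun k => integrable_mul_prodFun S hg (integrable_comp_pt k hi)
  simp_rw [← tsum_mul_right]
  refine ⟨integrable_tsum_of_summable_integral_norm hinteg hs, ?_⟩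
  rw [← (hasSum_integral_of_summable_integral_norm hinteg hs).tsum_eq]
  simp_rw [fun k : Fin r ↪ ℕ => integral_comp_pt_mul_prodFun (S := S) hg k hi]
  rw [tsum_mul_left, (hasSum_box (integrable_mul_blockProd hg hi)).tsum_eq,
    setIntegral_iUnion_box hf hr fun x hx => by rw [hx, zero_mul]]

lemma integral_partInt_mul_blockProd (hf : IsKernel n f) (hg : ∀ k, IsFactor (g k)) {r : ℕ}
    (hr : r ≤ n) :
    ∫ x : Fin r → ℝ, partInt f r x * blockProd S g x
      = ∫ z, f z * blockProd S g fun i : Fin r => z (splitEquiv hr (Sum.inl i)) := by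
  obtain ⟨C, hC⟩ := bounded_blockProd (S := S) hg (r := r)
  have hm : Measurable fun z : Fin n → ℝ =>
      blockProd S g fun i : Fin r => z (splitEquiv hr (Sum.inl i)) :=
    (measurable_blockProd hg).comp (measurable_pi_lambda _ fun i => measurable_pi_apply _)
  have hinteg : Integrable fun z : Fin n → ℝ =>
      f z * blockProd S g fun i : Fin r => z (splitEquiv hr (Sum.inl i)) :=
    hf.integrable.mul_bdd (c := C) hm.aestronglyMeasurable (ae_of_all _ fun z => hC _)
  have hmp := measurePreserving_join hr
  have e := integral_map (μ := (volume : Measure (Fin r → ℝ)).prod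
    (volume : Measure (Fin (n - r) → ℝ))) hmp.measurable.aemeasurable
    (f := fun z : Fin n → ℝ => f z * blockProd S g fun i : Fin r => z (splitEquiv hr (Sum.inl i)))
    (by rw [hmp.map_eq]; exact hinteg.aestronglyMeasurable)
  rw [hmp.map_eq] at e
  rw [e, integral_prod (fun p : (Fin r → ℝ) × (Fin (n - r) → ℝ) => f (join p.1 p.2) *
    blockProd S g fun i : Fin r => join p.1 p.2 (splitEquiv hr (Sum.inl i)))
    (hmp.integrable_comp_of_integrable hinteg)]
  refine integral_congr_ae (ae_of_all _ fun x => ?_)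
  simp only [join_inl, partInt]
  rw [integral_mul_const]

end

section Symmetry

variable {n : ℕ} {f : (Fin n → ℝ) → ℝ} {S : Finset ℕ} {g : ℕ → ℝ → ℝ}

lemma integral_comp_perm (σ : Equiv.Perm (Fin n)) (F : (Fin n → ℝ) → ℝ) :
    ∫ z : Fin n → ℝ, F (fun i => z (σ i)) = ∫ z, F z := by
  have h := volume_measurePreserving_piCongrLeft (fun _ : Fin n => ℝ) σ.symm
  rw [← h.integral_comp' F]
  refine integral_congr_ae (ae_of_all _ fun z => congrArg F ?_)
  ext i
  obtain ⟨i, rfl⟩ := σ.symm.surjective i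
  rw [MeasurableEquiv.coe_piCongrLeft, Equiv.piCongrLeft_apply_apply]
  simp

lemma exists_perm_comp_eq {α : Type*} {p q : α → Fin n} (hp : Function.Injective p)
    (hq : Function.Injective q) : ∃ σ : Equiv.Perm (Fin n), ∀ a, σ (q a) = p a := by
  classical
  set e : {x // x ∈ Set.range q} ≃ {x // x ∈ Set.range p} :=
    (Equiv.ofInjective q hq).symm.trans (Equiv.ofInjective p hp)
  refine ⟨e.extendSubtype, fun a => ?_⟩
  rw [e.extendSubtype_apply_of_mem (q a) ⟨a, rfl⟩]
  simp only [e, Equiv.trans_apply]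
  have : (Equiv.ofInjective q hq).symm ⟨q a, ⟨a, rfl⟩⟩ = a := by
    rw [Equiv.symm_apply_eq]; rfl
  rw [this]; rfl

lemma integral_mul_prod_onBlk_eq (hf : IsKernel n f) {p q : S → Fin n}
    (hp : Function.Injective p) (hq : Function.Injective q) :
    ∫ z, f z * ∏ j : S, onBlk j (g j) (z (p j)) = ∫ z, f z * ∏ j : S, onBlk j (g j) (z (q j)) := by
  obtain ⟨σ, hσ⟩ := exists_perm_comp_eq hp hq
  rw [← integral_comp_perm σ fun z => f z * ∏ j : S, onBlk j (g j) (z (q j))]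
  simp_rw [hσ]
  refine integral_congr_ae (ae_of_all _ fun z => ?_)
  dsimp only
  rw [← hf.symm σ z]
  rfl

lemma prod_onBlk_eq_zero {p : S → Fin n} (hp : ¬ Function.Injective p) (z : Fin n → ℝ) :
    ∏ j : S, onBlk j (g j) (z (p j)) = 0 := by
  simp only [Function.Injective, not_forall] at hp
  obtain ⟨a, b, hab, hne⟩ := hp
  by_cases h : z (p a) ∈ blk a
  · refine Finset.prod_eq_zero (Finset.mem_univ b) (onBlk_of_notMem (fun h' => hne ?_) _)
    rw [← hab] at h'
    exact Subtype.ext ((mem_blk_iff.1 h).2.symm.trans (mem_blk_iff.1 h').2)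
  · exact Finset.prod_eq_zero (Finset.mem_univ a) (onBlk_of_notMem h _)

lemma integrable_mul_prod_onBlk (hf : Integrable f) (hg : ∀ k, IsFactor (g k)) (p : S → Fin n) :
    Integrable fun z => f z * ∏ j : S, onBlk j (g j) (z (p j)) := by
  choose C hC using fun k => (hg k).bounded
  refine hf.mul_bdd (c := ∏ j : S, C j) ?_ (ae_of_all _ fun z => ?_)
  · have : Measurable fun z : Fin n → ℝ => ∏ j : S, onBlk j (g j) (z (p j)) :=
      Finset.measurable_fun_prod _ fun j _ => (measurable_onBlk j (hg j).measurable).comp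
        (measurable_pi_apply (p j))
    exact this.aestronglyMeasurable
  · rw [Real.norm_eq_abs, Finset.abs_prod]
    exact Finset.prod_le_prod (fun _ _ => abs_nonneg _) fun j _ => abs_onBlk_le j (hC j) _

/-- Expanding the product gives a sum over maps `p` from `S` to `Fin r`. Non-injective maps
contribute 0 since blocks are disjoint, injective ones all contribute the same number `A` since `f`
is symmetric, and there are `r.descFactorial S.card` of them. It matters that `A` does not depend on
`r`. -/
lemma integral_mul_blockProd (hf : IsKernel n f) (hg : ∀ k, IsFactor (g k)) :
    ∃ A : ℝ, ∀ (r : ℕ) (hr : r ≤ n),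
      ∫ z, f z * blockProd S g (fun i : Fin r => z (splitEquiv hr (Sum.inl i)))
        = (r.descFactorial S.card : ℝ) * A := by
  classical
  obtain ⟨A, hA⟩ : ∃ A : ℝ, ∀ p : S → Fin n, Function.Injective p →
      ∫ z, f z * ∏ j : S, onBlk j (g j) (z (p j)) = A := by
    by_cases h : ∃ q : S → Fin n, Function.Injective q
    · obtain ⟨q, hq⟩ := h
      exact ⟨_, fun p hp => integral_mul_prod_onBlk_eq hf hp hq⟩
    · exact ⟨0, fun p hp => (h ⟨p, hp⟩).elim⟩
  refine ⟨A, fun r hr => ?_⟩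
  have e : ∀ z : Fin n → ℝ,
      f z * blockProd S g (fun i : Fin r => z (splitEquiv hr (Sum.inl i)))
        = ∑ p : S → Fin r, f z * ∏ j : S,
          onBlk j (g j) (z (splitEquiv hr (Sum.inl (p j)))) := by
    intro z
    rw [← Finset.mul_sum, blockProd, ← Finset.prod_coe_sort S, Finset.prod_univ_sum,
      Fintype.piFinset_univ]
  simp_rw [e]
  rw [integral_finsetSum _ fun p _ => integrable_mul_prod_onBlk hf.integrable hg _]
  have hinj : Function.Injective fun i : Fin r => splitEquiv hr (Sum.inl i) :=
    (splitEquiv hr).injective.comp Sum.inl_injective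
  have e2 : ∀ p : S → Fin r, ∫ z, f z * ∏ j : S,
      onBlk j (g j) (z (splitEquiv hr (Sum.inl (p j))))
        = if Function.Injective p then A else 0 := by
    intro p
    split_ifs with hp
    · exact hA _ (hinj.comp hp)
    · have : ¬ Function.Injective fun j : S => splitEquiv hr (Sum.inl (p j)) :=
        fun h => hp (Function.Injective.of_comp (f := fun i : Fin r => splitEquiv hr (Sum.inl i)) h)
      simp_rw [fun z => prod_onBlk_eq_zero (g := g) this z]
      simp
  simp_rw [e2]
  rw [← Finset.sum_filter, Finset.sum_const, nsmul_eq_mul]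
  congr 2
  rw [← Fintype.card_subtype, Fintype.card_congr (Equiv.subtypeInjectiveEquivEmbedding S (Fin r)),
    Fintype.card_embedding_eq]
  simp

/-- A multiple integral of order `n` is orthogonal to the products of `m ≠ n` factors. -/
lemma integral_multInt_mul_prodFun (hf : IsKernel n f) (hg : ∀ k, IsFactor (g k))
    (hS : S.card ≠ n) : ∫ ω, multInt n f ω * prodFun S g ω ∂P = 0 := by
  obtain ⟨A, hA⟩ := integral_mul_blockProd (S := S) hf hg
  have e : ∀ ω, multInt n f ω * prodFun S g ω = ∑ r ∈ Finset.range (n + 1),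
      ((-1 : ℝ) ^ (n - r) / 2 ^ (n - r) * (n.choose r : ℝ)) *
        ((∑' k : Fin r ↪ ℕ, partInt f r (pt k ω)) * prodFun S g ω) := by
    intro ω
    rw [multInt, Finset.sum_mul]
    refine Finset.sum_congr rfl fun r _ => ?_
    simp_rw [mixedPoint_eq, partInt]
    ring
  have hle : ∀ r ∈ Finset.range (n + 1), r ≤ n := fun r hr => by
    rw [Finset.mem_range] at hr; omega
  simp_rw [e]
  rw [integral_finsetSum _ fun r hr =>
    (integral_tsum_mul_prodFun (S := S) hf hg (hle r hr)).1.const_mul _]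
  have e3 : ∀ r ∈ Finset.range (n + 1), ∫ ω, ((-1 : ℝ) ^ (n - r) / 2 ^ (n - r) * (n.choose r : ℝ)) *
        ((∑' k : Fin r ↪ ℕ, partInt f r (pt k ω)) * prodFun S g ω) ∂P
      = (2⁻¹ ^ n * A) * ((-1 : ℝ) ^ (n - r) * (n.choose r : ℝ) * (r.descFactorial S.card : ℝ)) := by
    intro r hr
    rw [integral_const_mul, (integral_tsum_mul_prodFun (S := S) hf hg (hle r hr)).2,
      integral_partInt_mul_blockProd hf hg (hle r hr), hA r (hle r hr)]
    -- The weight in `multInt` and the density of the random points combine to `2⁻ⁿ` whatever `r`,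
    -- leaving the alternating sum of falling factorials.
    have : (2⁻¹ : ℝ) ^ n = 2⁻¹ ^ (n - r) * 2⁻¹ ^ r := by
      rw [← pow_add, Nat.sub_add_cancel (hle r hr)]
    rw [this, div_eq_mul_inv, ← inv_pow]
    ring
  rw [Finset.sum_congr rfl e3, ← Finset.mul_sum, sum_neg_one_pow_choose_descFactorial hS, mul_zero]

end Symmetry

open scoped InnerProductSpace

lemma hoeff_isOrtho_chaos {S : Finset ℕ} {n : ℕ} (hS : S.card ≠ n) : hoeff S ⟂ chaos n := by
  refine hoeff_isOrtho_of_gen ?_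
  rintro Z ⟨g, hg, hZ⟩ Y hY
  have h : chaos n ≤ (Submodule.span ℝ {Z})ᗮ := by
    refine Submodule.topologicalClosure_minimal _ (Submodule.span_le.2 ?_)
      (Submodule.isClosed_orthogonal _)
    rintro W ⟨f, hf, hW⟩
    rw [SetLike.mem_coe, Submodule.mem_orthogonal_singleton_iff_inner_right, real_inner_comm,
      inner_eq_integral_of_ae _ hZ, ← integral_multInt_mul_prodFun hf hg hS]
    refine integral_congr_ae ?_
    filter_upwards [hW] with ω hω
    rw [hω]
  exact Submodule.mem_orthogonal_singleton_iff_inner_right.1 (h hY)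

end UniformSeq

end

/-! ### The inverse Ornstein-Uhlenbeck operator on Hoeffding components. -/

noncomputable section

namespace UniformSeq

open scoped InnerProductSpace

lemma starProjection_hoeff_chaos (S : Finset ℕ) (n : ℕ) (X : Lp ℝ 2 P) :
    (hoeff S).starProjection ((chaos n).starProjection X)
      = if S.card = n then (hoeff S).starProjection X else 0 := by
  split_ifs with h
  · subst h
    exact DFunLike.congr_fun
      (Submodule.starProjection_comp_starProjection_of_le (hoeff_le_chaos S)) X
  · exact DFunLike.congr_fun
      (hoeff_isOrtho_chaos h).starProjection_comp_starProjection X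

/-- The composite of the two projections has all its Hoeffding components equal to 0, since the
order of a component can match only one of `m` and `n`. -/
lemma pairwise_chaos_isOrtho : Pairwise fun m n => chaos m ⟂ chaos n := by
  intro m n hmn
  rw [← Submodule.starProjection_comp_starProjection_eq_zero_iff]
  ext1 X
  refine (hasSum_starProjection_of_dense pairwise_hoeff_isOrtho dense_iSup_hoeff _).unique ?_
  rw [zero_apply]
  convert hasSum_zero with S
  rw [ContinuousLinearMap.comp_apply, starProjection_hoeff_chaos]
  split_ifs with h
  · rw [starProjection_hoeff_chaos, if_neg (h ▸ hmn)]
  · rfl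

/-- Bessel's inequality for the orthogonal chaoses. Without summability the `tsum` in `Linv` would
be 0 by default. -/
lemma summable_Linv (X : Lp ℝ 2 P) :
    Summable fun n : ℕ => (1 / ((n : ℝ) + 1)) • (chaos (n + 1)).starProjection X := by
  have hof : OrthogonalFamily ℝ (fun n => chaos (n + 1)) fun n => (chaos (n + 1)).subtypeₗᵢ :=
    OrthogonalFamily.of_pairwise fun i j hij => pairwise_chaos_isOrtho (by simpa using hij)
  have h1 : Summable fun n : ℕ => ‖(chaos (n + 1)).starProjection X‖ ^ 2 := by
    refine summable_of_sum_le (c := ‖X‖ ^ 2) (fun n => sq_nonneg _) fun s => ?_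
    set Y := ∑ n ∈ s, (chaos (n + 1)).starProjection X
    have e1 : ∑ n ∈ s, ‖(chaos (n + 1)).starProjection X‖ ^ 2 = ⟪Y, X⟫_ℝ := by
      rw [sum_inner]
      exact Finset.sum_congr rfl fun n _ => (inner_starProjection_self _ X).symm
    have e2 : ‖Y‖ ^ 2 = ∑ n ∈ s, ‖(chaos (n + 1)).starProjection X‖ ^ 2 :=
      hof.norm_sum (fun n => ⟨_, Submodule.starProjection_apply_mem (chaos (n + 1)) X⟩) s
    have e3 := real_inner_le_norm Y X
    nlinarith [norm_nonneg Y, norm_nonneg X, sq_nonneg (‖X‖ - ‖Y‖)]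
  have h2 := (hof.summable_iff_norm_sq_summable fun n => (1 / ((n : ℝ) + 1)) •
    ⟨_, Submodule.starProjection_apply_mem (chaos (n + 1)) X⟩).2 ?_
  · simpa using h2
  · refine Summable.of_nonneg_of_le (fun n => sq_nonneg _) (fun n => ?_) h1
    refine pow_le_pow_left₀ (norm_nonneg _) ?_ 2
    rw [norm_smul]
    refine mul_le_of_le_one_left (norm_nonneg _) ?_
    rw [Real.norm_of_nonneg (by positivity), div_le_one (by positivity)]
    have : (0 : ℝ) ≤ n := by positivity
    linarith

lemma starProjection_Linv (S : Finset ℕ) (X : Lp ℝ 2 P) :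
    (hoeff S).starProjection (Linv X) = -((S.card : ℝ)⁻¹ • (hoeff S).starProjection X) := by
  rw [Linv, map_neg, ContinuousLinearMap.map_tsum _ (summable_Linv X)]
  simp_rw [map_smul, starProjection_hoeff_chaos]
  -- For empty `S` both sides are 0: the sum runs over orders `n + 1` only, and the inverse of 0 is
  -- 0.
  rcases Nat.eq_zero_or_pos S.card with h | h
  · simp [h]
  · rw [tsum_eq_single (S.card - 1)]
    · have h2 : S.card = S.card - 1 + 1 := by omega
      have h1 : ((S.card - 1 : ℕ) : ℝ) + 1 = S.card := by exact_mod_cast h2.symm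
      rw [if_pos h2, h1, one_div]
    · intro n hn
      rw [if_neg (by omega), smul_zero]

lemma card_smul_starProjection_Linv {X : Lp ℝ 2 P} (hX0 : ∫ ω, X ω ∂P = 0) (S : Finset ℕ) :
    (S.card : ℝ) • (hoeff S).starProjection (Linv X) = -(hoeff S).starProjection X := by
  rcases S.eq_empty_or_nonempty with rfl | h
  · have : (hoeff ∅).starProjection X = (hoeff ∅).starProjection 0 := by
      refine starProjection_hoeff_eq ?_
      rintro Z ⟨g, hg, hZ⟩
      rw [inner_eq_integral_of_ae _ hZ, inner_zero_left]
      simpa [prodFun] using hX0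
    simp [this]
  · have : (S.card : ℝ) ≠ 0 := by exact_mod_cast h.card_pos.ne'
    rw [starProjection_Linv, smul_neg, smul_smul, mul_inv_cancel₀ this, one_smul]

lemma norm_starProjection_Linv_le (S : Finset ℕ) (X : Lp ℝ 2 P) :
    ‖(hoeff S).starProjection (Linv X)‖ ≤ ‖(hoeff S).starProjection X‖ := by
  rw [starProjection_Linv, norm_neg, norm_smul]
  refine mul_le_of_le_one_left (norm_nonneg _) ?_
  rw [Real.norm_of_nonneg (by positivity)]
  exact Nat.cast_inv_le_one _

/-- The variables `dif k (L⁻¹ X)` are square summable. -/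
lemma summable_norm_difLp_Linv {X : Lp ℝ 2 P} (hX0 : ∫ ω, X ω ∂P = 0) :
    Summable fun k => ‖difLp k (Linv X)‖ ^ 2 := by
  have hs := hasSum_norm_sq_starProjection_of_dense pairwise_hoeff_isOrtho dense_iSup_hoeff X
  refine (hasSum_of_hasSum_ite_mem (c := fun S => ‖(hoeff S).starProjection (Linv X)‖ ^ 2)
    ?_ fun k => ?_).summable
  -- One factor `|S|⁻¹` of `L⁻¹` absorbs the weight `|S|` and the other is at most 1, so the terms
  -- are dominated by those of `‖X‖²`.
  · refine Summable.of_nonneg_of_le (fun S => by positivity) (fun S => ?_) hs.summable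
    rw [abs_of_nonneg (sq_nonneg _)]
    have h1 := norm_starProjection_Linv_le S X
    have h2 := congrArg norm (card_smul_starProjection_Linv hX0 S)
    rw [norm_smul, norm_neg, Real.norm_of_nonneg (by positivity)] at h2
    calc _ = ((S.card : ℝ) * ‖(hoeff S).starProjection (Linv X)‖) *
          ‖(hoeff S).starProjection (Linv X)‖ := by ring
      _ ≤ _ := by rw [h2, sq]; gcongr
  · have := hasSum_norm_sq_starProjection_of_dense pairwise_hoeff_isOrtho dense_iSup_hoeff
      (difLp k (Linv X))
    convert this using 2 with S
    rw [starProjection_difLp]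
    split_ifs <;> simp

/-- The integration by parts formula `∑_k E[(dif k (L⁻¹ X)) Z] = -E[X Z]`. -/
lemma hasSum_inner_difLp_Linv {X : Lp ℝ 2 P} (hX0 : ∫ ω, X ω ∂P = 0) (Z : Lp ℝ 2 P) :
    HasSum (fun k => ⟪difLp k (Linv X), Z⟫_ℝ) (-⟪X, Z⟫_ℝ) := by
  have hX := hasSum_norm_sq_starProjection_of_dense pairwise_hoeff_isOrtho dense_iSup_hoeff X
  have hZ := hasSum_norm_sq_starProjection_of_dense pairwise_hoeff_isOrtho dense_iSup_hoeff Z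
  have e : ∀ S : Finset ℕ, (S.card : ℝ) * ⟪(hoeff S).starProjection (Linv X), Z⟫_ℝ
      = -⟪(hoeff S).starProjection X, Z⟫_ℝ := fun S => by
    rw [← real_inner_smul_left, card_smul_starProjection_Linv hX0, inner_neg_left]
  have h1 := hasSum_of_hasSum_ite_mem
    (c := fun S => ⟪(hoeff S).starProjection (Linv X), Z⟫_ℝ)
    (d := fun k => ⟪difLp k (Linv X), Z⟫_ℝ) ?_ fun k => ?_
  · simp_rw [e] at h1
    rwa [tsum_neg, (hasSum_inner_starProjection_of_dense pairwise_hoeff_isOrtho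
      dense_iSup_hoeff X Z).tsum_eq] at h1
  · refine Summable.of_nonneg_of_le (fun S => by positivity) (fun S => ?_)
      (hX.summable.add hZ.summable)
    rw [← abs_of_nonneg (Nat.cast_nonneg (α := ℝ) S.card), ← abs_mul, e, abs_neg]
    have e2 : ⟪(hoeff S).starProjection X, Z⟫_ℝ
        = ⟪(hoeff S).starProjection X, (hoeff S).starProjection Z⟫_ℝ := by
      rw [← Submodule.inner_starProjection_left_eq_right,
        Submodule.starProjection_eq_self_iff.2 (Submodule.starProjection_apply_mem _ X)]
    rw [e2]
    refine (abs_real_inner_le_norm _ _).trans ?_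
    nlinarith [sq_nonneg (‖(hoeff S).starProjection X‖ - ‖(hoeff S).starProjection Z‖),
      sq_nonneg ‖(hoeff S).starProjection X‖, sq_nonneg ‖(hoeff S).starProjection Z‖]
  · have := hasSum_inner_starProjection_of_dense pairwise_hoeff_isOrtho dense_iSup_hoeff
      (difLp k (Linv X)) Z
    convert this using 2 with S
    rw [starProjection_difLp]
    split_ifs <;> simp

end UniformSeq

end

/-! ### Elementary inequalities for squares. -/

lemma enorm_sq_eq_ofReal (y : ℝ) : ‖y‖ₑ ^ 2 = ENNReal.ofReal (y ^ 2) := by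
  rw [Real.enorm_eq_ofReal_abs, ← ENNReal.ofReal_pow (abs_nonneg _), sq_abs]

lemma enorm_mul_le_add_sq (a b : ℝ) : ‖a * b‖ₑ ≤ ‖a‖ₑ ^ 2 + ‖b‖ₑ ^ 2 := by
  rw [enorm_mul]
  rcases le_total ‖a‖ₑ ‖b‖ₑ with h | h
  · calc ‖a‖ₑ * ‖b‖ₑ ≤ ‖b‖ₑ * ‖b‖ₑ := by gcongr
      _ = ‖b‖ₑ ^ 2 := (sq _).symm
      _ ≤ _ := le_add_self
  · calc ‖a‖ₑ * ‖b‖ₑ ≤ ‖a‖ₑ * ‖a‖ₑ := by gcongr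
      _ = ‖a‖ₑ ^ 2 := (sq _).symm
      _ ≤ _ := le_self_add

/-- The second moment of a centered variable around a point. -/
lemma lintegral_enorm_sub_sq {α : Type*} [MeasurableSpace α] {μ : Measure α}
    [IsProbabilityMeasure μ] {a : α → ℝ} (ha : MemLp a 2 μ) (h0 : ∫ v, a v ∂μ = 0) (c : ℝ) :
    ∫⁻ v, ‖c - a v‖ₑ ^ 2 ∂μ = ‖c‖ₑ ^ 2 + ∫⁻ v, ‖a v‖ₑ ^ 2 ∂μ := by
  have h1 : MemLp (fun v => c - a v) 2 μ := (memLp_const c).sub ha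
  have hai : Integrable a μ := ha.integrable (by norm_num)
  simp_rw [enorm_sq_eq_ofReal]
  rw [← ofReal_integral_eq_lintegral_ofReal h1.integrable_sq (ae_of_all _ fun v => sq_nonneg _),
    ← ofReal_integral_eq_lintegral_ofReal ha.integrable_sq (ae_of_all _ fun v => sq_nonneg _),
    ← ENNReal.ofReal_add (sq_nonneg _) (integral_nonneg fun v => sq_nonneg _)]
  congr 1
  have e : ∀ v, (c - a v) ^ 2 = c ^ 2 - 2 * c * a v + a v ^ 2 := fun v => by ring
  simp_rw [e]
  have hi : Integrable (fun v => c ^ 2 - 2 * c * a v) μ :=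
    (integrable_const _).sub (hai.const_mul _)
  rw [integral_add hi ha.integrable_sq, integral_sub (integrable_const _) (hai.const_mul _), integral_const_mul, h0]
  simp

noncomputable section

namespace UniformSeq

open scoped InnerProductSpace

/-! ### Integrals of `nabla` as series over the coordinates. -/

section

variable {x w : Ω → ℝ}

lemma measurable_dif_update (k : ℕ) (hm : Measurable x) :
    Measurable fun p : Ω × ℝ => dif k x (Function.update p.1 k p.2) :=
  (measurable_dif k hm).comp (measurable_update_prod k)

lemma measurable_dif_update_right (k : ℕ) (hm : Measurable x) (ω : Ω) :
    Measurable fun u => dif k x (Function.update ω k u) :=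
  (measurable_dif_update k hm).comp measurable_prodMk_left

lemma lintegral_Ici_nabla (ω : Ω) (F : ℝ≥0∞ → ℝ≥0∞ → ℝ≥0∞) :
    ∫⁻ t in Set.Ici (0 : ℝ), F ‖nabla t x ω‖ₑ ‖nabla t w ω‖ₑ = ∑' k : ℕ, 2 * ∫⁻ u,
      F ‖dif k x (Function.update ω k u)‖ₑ ‖dif k w (Function.update ω k u)‖ₑ ∂unif := by
  rw [lintegral_Ici]
  refine tsum_congr fun k => ?_
  congr 1
  refine lintegral_congr_ae ?_
  filter_upwards [ae_unif] with u hu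
  rw [nabla_shift k hu, nabla_shift k hu]

lemma lintegral_lintegral_nabla (hmx : Measurable x) (hmw : Measurable w)
    {F : ℝ≥0∞ → ℝ≥0∞ → ℝ≥0∞} (hF : Measurable (Function.uncurry F)) :
    ∫⁻ ω, (∫⁻ t in Set.Ici (0 : ℝ), F ‖nabla t x ω‖ₑ ‖nabla t w ω‖ₑ) ∂P
      = ∑' k : ℕ, 2 * ∫⁻ ω, F ‖dif k x ω‖ₑ ‖dif k w ω‖ₑ ∂P := by
  have hd : ∀ k, Measurable fun ω => F ‖dif k x ω‖ₑ ‖dif k w ω‖ₑ := fun k =>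
    hF.comp ((measurable_dif k hmx).enorm.prodMk (measurable_dif k hmw).enorm)
  simp_rw [lintegral_Ici_nabla]
  rw [lintegral_tsum]
  · refine tsum_congr fun k => ?_
    rw [lintegral_const_mul', lintegral_resample k (hd k)]
    simp
  · intro k
    exact (((hd k).comp (measurable_update_prod k)).lintegral_prod_right'.const_mul 2).aemeasurable

lemma tsum_lintegral_dif_sq_lt_top {X : Lp ℝ 2 P} (hX : X ∈ DomNabla) :
    ∑' k : ℕ, ∫⁻ ω, ‖dif k X ω‖ₑ ^ 2 ∂P < ∞ := by
  have hm : Measurable X := (Lp.stronglyMeasurable X).measurable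
  have h : ∫⁻ ω, (∫⁻ t in Set.Ici (0 : ℝ), ‖nabla t X ω‖ₑ ^ 2) ∂P < ∞ := hX
  rw [lintegral_lintegral_nabla (F := fun a _ => a ^ 2) hm hm (measurable_fst.pow_const 2)] at h
  refine lt_of_le_of_lt (ENNReal.tsum_le_tsum fun k => ?_) h
  exact le_mul_of_one_le_left (by simp) (by norm_num)

lemma lintegral_dif_sq (k : ℕ) (Y : Lp ℝ 2 P) :
    ∫⁻ ω, ‖dif k Y ω‖ₑ ^ 2 ∂P = ENNReal.ofReal (‖difLp k Y‖ ^ 2) := by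
  have h := memLp_dif k (Lp.stronglyMeasurable Y).measurable (Lp.memLp Y)
  simp_rw [enorm_sq_eq_ofReal]
  rw [← ofReal_integral_eq_lintegral_ofReal h.integrable_sq (ae_of_all _ fun v => sq_nonneg _),
    ← real_inner_self_eq_norm_sq, inner_eq_integral_of_ae _ (coeFn_difLp k Y)]
  congr 1
  refine integral_congr_ae ?_
  filter_upwards [coeFn_difLp k Y] with ω hω
  rw [hω, sq]

lemma tsum_lintegral_dif_Linv_sq_lt_top {X : Lp ℝ 2 P} (hX0 : ∫ ω, X ω ∂P = 0) :
    ∑' k : ℕ, ∫⁻ ω, ‖dif k (Linv X) ω‖ₑ ^ 2 ∂P < ∞ := by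
  simp_rw [lintegral_dif_sq]
  exact (summable_norm_difLp_Linv hX0).tsum_ofReal_lt_top

lemma tsum_lintegral_dif_mul_lt_top (hmx : Measurable x)
    (hx : ∑' k : ℕ, ∫⁻ ω, ‖dif k x ω‖ₑ ^ 2 ∂P < ∞)
    (hw : ∑' k : ℕ, ∫⁻ ω, ‖dif k w ω‖ₑ ^ 2 ∂P < ∞) :
    ∑' k : ℕ, ∫⁻ ω, ‖dif k x ω * dif k w ω‖ₑ ∂P < ∞ := by
  refine lt_of_le_of_lt ?_ (ENNReal.add_lt_top.2 ⟨hx, hw⟩)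
  rw [← ENNReal.tsum_add]
  refine ENNReal.tsum_le_tsum fun k => ?_
  rw [← lintegral_add_left ((measurable_dif k hmx).enorm.pow_const 2)]
  exact lintegral_mono fun ω => enorm_mul_le_add_sq _ _

lemma ae_integrableOn_nabla_mul (hmx : Measurable x) (hmw : Measurable w)
    (h : ∑' k : ℕ, ∫⁻ ω, ‖dif k x ω * dif k w ω‖ₑ ∂P < ∞) :
    ∀ᵐ ω ∂P, IntegrableOn (fun t : ℝ => nabla t x ω * -nabla t w ω) (Set.Ici 0) := by
  have hprod : Measurable fun p : ℝ × Ω => nabla p.1 x p.2 * -nabla p.1 w p.2 :=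
    (measurable_nabla hmx).mul (measurable_nabla hmw).neg
  have h1 : ∀ᵐ ω ∂P, ∫⁻ t in Set.Ici (0 : ℝ), ‖nabla t x ω * -nabla t w ω‖ₑ < ∞ := by
    refine ae_lt_top ?_ (ne_of_lt ?_)
    · exact (hprod.comp measurable_swap).enorm.lintegral_prod_right'
    · simp_rw [enorm_mul, enorm_neg] at h ⊢
      rw [lintegral_lintegral_nabla (F := fun a b => a * b) hmx hmw measurable_mul,
        ENNReal.tsum_mul_left]
      exact ENNReal.mul_lt_top (by simp) h
  filter_upwards [h1] with ω hω
  exact ⟨(hprod.comp measurable_prodMk_right).aestronglyMeasurable, hω⟩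

/-- The covariance of `x` and `w` in the coordinate `k`. -/
def cov (k : ℕ) (x w : Ω → ℝ) (ω : Ω) : ℝ :=
  ∫ u, dif k x (Function.update ω k u) * dif k w (Function.update ω k u) ∂unif

lemma half_integral_nabla_mul {ω : Ω}
    (h : IntegrableOn (fun t : ℝ => nabla t x ω * -nabla t w ω) (Set.Ici 0)) :
    1 / 2 * ∫ t in Set.Ici (0 : ℝ), nabla t x ω * -nabla t w ω = -∑' k, cov k x w ω := by
  have h1 := (hasSum_integral_Ici h).tsum_eq
  rw [← h1, tsum_mul_left, ← mul_assoc, ← tsum_neg]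
  norm_num
  refine tsum_congr fun k => ?_
  rw [cov, ← integral_neg]
  refine integral_congr_ae ?_
  filter_upwards [ae_unif] with u hu
  rw [nabla_shift k hu, nabla_shift k hu, neg_mul_eq_mul_neg]

lemma integrable_dif_mul (k : ℕ) (hmx : Measurable x) (hx : MemLp x 2 P) (hmw : Measurable w)
    (hw : MemLp w 2 P) : Integrable (fun ω => dif k x ω * dif k w ω) P :=
  (memLp_dif k hmx hx).integrable_mul (memLp_dif k hmw hw)

lemma integrable_cov (k : ℕ) (hmx : Measurable x) (hx : MemLp x 2 P) (hmw : Measurable w)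
    (hw : MemLp w 2 P) : Integrable (cov k x w) P :=
  (integrable_resample k (integrable_dif_mul k hmx hx hmw hw)).integral_prod_left

lemma lintegral_cov_le (k : ℕ) (hmx : Measurable x) (hmw : Measurable w) :
    ∫⁻ ω, ‖cov k x w ω‖ₑ ∂P ≤ ∫⁻ ω, ‖dif k x ω * dif k w ω‖ₑ ∂P := by
  rw [← lintegral_resample k (F := fun ω => ‖dif k x ω * dif k w ω‖ₑ)
    ((measurable_dif k hmx).mul (measurable_dif k hmw)).enorm]
  exact lintegral_mono fun ω => enorm_integral_le_lintegral_enorm _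

/-! ### The Taylor expansion in one coordinate -/

variable {f f' : ℝ → ℝ}

lemma ae_integral_taylor (k : ℕ) (hmx : Measurable x) (hx : MemLp x 2 P) (hmw : Measurable w)
    (hw : MemLp w 2 P) (hfc : Continuous f) (hfb : ∀ y, |f y| ≤ 1) :
    ∀ᵐ ω ∂P, (∫ u, dif k w (Function.update ω k u) * f (x (Function.update ω k u)) ∂unif)
        - f' (x ω) * cov k x w ω
      = ∫ u, dif k w (Function.update ω k u) * (f (x (Function.update ω k u)) - f (x ω)
          - f' (x ω) * (x (Function.update ω k u) - x ω)) ∂unif := by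
  filter_upwards [ae_integral_dif_update k hmw hw, ae_memLp_dif_update k hmw hw,
    ae_memLp_dif_update k hmx hx] with ω h0 hb ha
  have hbi := hb.integrable (by norm_num : (1 : ℝ≥0∞) ≤ 2)
  have hab := ha.integrable_mul hb
  have hbf : Integrable (fun u => dif k w (Function.update ω k u) *
      f (x (Function.update ω k u))) unif := by
    refine hbi.mul_bdd (c := 1) ?_ (ae_of_all _ fun u => hfb _)
    exact (hfc.measurable.comp (hmx.comp ((measurable_update_prod k).comp
      measurable_prodMk_left))).aestronglyMeasurable
  -- The increment of `x` is `dif k x` at the updated point plus a term free of `u`. All terms free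
  -- of `u` multiply the factor `dif k w`, which has mean 0 in `u`, and disappear.
  have e : ∀ u, dif k w (Function.update ω k u) * (f (x (Function.update ω k u)) - f (x ω)
          - f' (x ω) * (x (Function.update ω k u) - x ω))
      = dif k w (Function.update ω k u) * f (x (Function.update ω k u))
        - f' (x ω) * (dif k x (Function.update ω k u) * dif k w (Function.update ω k u))
        - (f (x ω) + f' (x ω) * (avg k x ω - x ω)) * dif k w (Function.update ω k u) := by
    intro u
    rw [dif_update k x]
    ring
  simp_rw [e]
  rw [integral_sub, integral_sub hbf, integral_const_mul, integral_const_mul, h0, mul_zero,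
    sub_zero, cov]
  · exact hab.const_mul _
  · exact hbf.sub (hab.const_mul _)
  · exact hbi.const_mul _

/-- The cost of replacing `dif k (f ∘ x)` by its linearisation. -/
def remainder (k : ℕ) (x w : Ω → ℝ) : ℝ≥0∞ :=
  ∫⁻ ω, (∫⁻ u, ‖dif k w (Function.update ω k u)‖ₑ *
    ‖x (Function.update ω k u) - x ω‖ₑ ^ 2 ∂unif) ∂P

lemma enorm_sub_le_remainder (k : ℕ) (hmx : Measurable x) (hx : MemLp x 2 P) (hmw : Measurable w)
    (hw : MemLp w 2 P) (hfc : Continuous f) (hfb : ∀ y, |f y| ≤ 1) (hfc' : Continuous f')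
    (hfb' : ∀ y, |f' y| ≤ 1) (htaylor : ∀ y z, |f z - f y - f' y * (z - y)| ≤ (z - y) ^ 2) :
    ‖(∫ ω, dif k w ω * f (x ω) ∂P) - ∫ ω, f' (x ω) * cov k x w ω ∂P‖ₑ ≤ remainder k x w := by
  have h1 : Integrable (fun ω => dif k w ω * f (x ω)) P :=
    ((memLp_dif k hmw hw).integrable (by norm_num)).mul_bdd (c := 1)
      (hfc.measurable.comp hmx).aestronglyMeasurable (ae_of_all _ fun u => hfb _)
  have h2 : Integrable (fun ω => f' (x ω) * cov k x w ω) P :=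
    (integrable_cov k hmx hx hmw hw).bdd_mul (c := 1)
      (hfc'.measurable.comp hmx).aestronglyMeasurable (ae_of_all _ fun u => hfb' _)
  rw [← integral_resample k h1, ← integral_sub (integrable_resample k h1).integral_prod_left h2,
    integral_congr_ae (ae_integral_taylor (f' := f') k hmx hx hmw hw hfc hfb)]
  refine (enorm_integral_le_lintegral_enorm _).trans (lintegral_mono fun ω => ?_)
  refine (enorm_integral_le_lintegral_enorm _).trans (lintegral_mono fun u => ?_)
  dsimp only
  rw [enorm_mul]
  gcongr
  rw [enorm_sq_eq_ofReal, Real.enorm_eq_ofReal_abs]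
  exact ENNReal.ofReal_le_ofReal (htaylor _ _)

/-- Coordinate `k` of the base point is resampled too, to a value `v` independent of `u`. The
increment becomes a difference of two values of `dif k x`, and integrating its square in `v` gives a
square plus a variance by centering. -/
lemma remainder_eq (k : ℕ) (hmx : Measurable x) (hx : MemLp x 2 P) (hmw : Measurable w) :
    remainder k x w = (∫⁻ ω, ‖dif k w ω‖ₑ * ‖dif k x ω‖ₑ ^ 2 ∂P)
      + ∫⁻ ω, (∫⁻ u, ‖dif k w (Function.update ω k u)‖ₑ *
          ∫⁻ v, ‖dif k x (Function.update ω k v)‖ₑ ^ 2 ∂unif ∂unif) ∂P := by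
  have hup := measurable_update_prod k
  have hmF : Measurable fun ω => ∫⁻ u, ‖dif k w (Function.update ω k u)‖ₑ *
      ‖x (Function.update ω k u) - x ω‖ₑ ^ 2 ∂unif := by
    refine Measurable.lintegral_prod_right' (f := fun p : Ω × ℝ =>
      ‖dif k w (Function.update p.1 k p.2)‖ₑ * ‖x (Function.update p.1 k p.2) - x p.1‖ₑ ^ 2) ?_
    exact (measurable_dif_update k hmw).enorm.mul
      (((hmx.comp hup).sub (hmx.comp measurable_fst)).enorm.pow_const 2)
  have hwx : Measurable fun ω => ‖dif k w ω‖ₑ * ‖dif k x ω‖ₑ ^ 2 :=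
    (measurable_dif k hmw).enorm.mul ((measurable_dif k hmx).enorm.pow_const 2)
  rw [remainder, ← lintegral_resample k hmF, ← lintegral_resample k hwx, ← lintegral_add_left]
  swap
  · exact (hwx.comp hup).lintegral_prod_right'
  refine lintegral_congr_ae ?_
  filter_upwards [ae_integral_dif_update k hmx hx, ae_memLp_dif_update k hmx hx] with ω h0 ha
  simp only [Function.update_idem]
  have hmw' := measurable_dif_update_right k hmw ω
  have hmx' := measurable_dif_update_right k hmx ω
  have e : ∀ u v, x (Function.update ω k u) - x (Function.update ω k v)
      = dif k x (Function.update ω k u) - dif k x (Function.update ω k v) := fun u v => by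
    rw [dif_update, dif_update]; ring
  simp_rw [e]
  rw [lintegral_lintegral_swap, ← lintegral_add_left]
  · refine lintegral_congr fun u => ?_
    rw [lintegral_const_mul, lintegral_enorm_sub_sq ha h0, mul_add]
    exact (measurable_const.sub hmx').enorm.pow_const 2
  · exact hmw'.enorm.mul (hmx'.enorm.pow_const 2)
  · refine Measurable.aemeasurable ?_
    exact (hmw'.comp measurable_snd).enorm.mul
      (((hmx'.comp measurable_snd).sub (hmx'.comp measurable_fst)).enorm.pow_const 2)

lemma lintegral_lintegral_nabla_block (hmx : Measurable x) (hmw : Measurable w) :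
    ∫⁻ ω, (∫⁻ t in Set.Ici (0 : ℝ), ‖nabla t w ω‖ₑ * ∫⁻ s in block t, ‖nabla s x ω‖ₑ ^ 2) ∂P
      = ∑' k : ℕ, 4 * ∫⁻ ω, (∫⁻ u, ‖dif k w (Function.update ω k u)‖ₑ *
          ∫⁻ v, ‖dif k x (Function.update ω k v)‖ₑ ^ 2 ∂unif ∂unif) ∂P := by
  have e : ∀ ω, ∫⁻ t in Set.Ici (0 : ℝ), ‖nabla t w ω‖ₑ * ∫⁻ s in block t, ‖nabla s x ω‖ₑ ^ 2
      = ∑' k : ℕ, 4 * ∫⁻ u, ‖dif k w (Function.update ω k u)‖ₑ *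
          ∫⁻ v, ‖dif k x (Function.update ω k v)‖ₑ ^ 2 ∂unif ∂unif := by
    intro ω
    rw [lintegral_Ici]
    refine tsum_congr fun k => ?_
    have e1 : ∀ᵐ u ∂unif, ‖nabla (2 * (k : ℝ) + 1 + u) w ω‖ₑ *
        ∫⁻ s in block (2 * (k : ℝ) + 1 + u), ‖nabla s x ω‖ₑ ^ 2
        = 2 * (‖dif k w (Function.update ω k u)‖ₑ *
          ∫⁻ v, ‖dif k x (Function.update ω k v)‖ₑ ^ 2 ∂unif) := by
      filter_upwards [ae_unif] with u hu
      rw [nabla_shift k hu, block_shift k hu, lintegral_blk, mul_left_comm]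
      congr 2
      refine lintegral_congr_ae ?_
      filter_upwards [ae_unif] with v hv
      rw [nabla_shift k hv]
    rw [lintegral_congr_ae e1, lintegral_const_mul' _ _ (by simp), ← mul_assoc]
    norm_num
  simp_rw [e]
  rw [lintegral_tsum]
  · exact tsum_congr fun k => lintegral_const_mul' _ _ (by simp)
  · intro k
    refine Measurable.aemeasurable (Measurable.const_mul ?_ _)
    have hin : Measurable fun ω => ∫⁻ v, ‖dif k x (Function.update ω k v)‖ₑ ^ 2 ∂unif :=
      ((measurable_dif_update k hmx).enorm.pow_const 2).lintegral_prod_right'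
    exact ((measurable_dif_update k hmw).enorm.mul
      (hin.comp measurable_fst)).lintegral_prod_right'

/-- The coefficients are inverse block lengths: a single integral over a block carries a factor 2
relative to the uniform law, a double integral a factor 4. -/
lemma tsum_remainder (hmx : Measurable x) (hx : MemLp x 2 P) (hmw : Measurable w) :
    ∑' k, remainder k x w =
      1 / 2 * (∫⁻ ω, (∫⁻ t in Set.Ici (0 : ℝ), ‖nabla t w ω‖ₑ * ‖nabla t x ω‖ₑ ^ 2) ∂P)
      + 1 / 4 * (∫⁻ ω, (∫⁻ t in Set.Ici (0 : ℝ), ‖nabla t w ω‖ₑ *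
          ∫⁻ s in block t, ‖nabla s x ω‖ₑ ^ 2) ∂P) := by
  rw [lintegral_lintegral_nabla_block hmx hmw, lintegral_lintegral_nabla (F := fun a b => a * b ^ 2)
    hmw hmx (measurable_fst.mul (measurable_snd.pow_const 2)), ENNReal.tsum_mul_left,
    ENNReal.tsum_mul_left, ← mul_assoc, ← mul_assoc, one_div, one_div,
    ENNReal.inv_mul_cancel (by simp) (by simp), ENNReal.inv_mul_cancel (by simp) (by simp),
    one_mul, one_mul, ← ENNReal.tsum_add]
  exact tsum_congr fun k => remainder_eq k hmx hx hmw

end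

/-! ### Assembly of the bound. -/

/-- The bound for a single test function. -/
lemma enorm_integral_sub_gaussian_le {X : Lp ℝ 2 P} (hX : X ∈ DomNabla) (hX0 : ∫ ω, X ω ∂P = 0)
    {h : ℝ → ℝ} (hh : LipschitzWith 1 h) :
    ‖∫ y, h y ∂(P.map X) - ∫ y, h y ∂(gaussianReal 0 1)‖ₑ ≤
      (∫⁻ ω, ‖1 - 1 / 2 * ∫ t in Set.Ici (0 : ℝ), nabla t X ω * -nabla t (Linv X) ω‖ₑ ∂P)
        + ∑' k, remainder k X (Linv X) := by
  obtain ⟨f, f', hf, hfc', hstein, hfb, hfb', htaylor⟩ := Stein.exists_solution hh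
  have hfc : Continuous f := continuous_iff_continuousAt.2 fun y => (hf y).continuousAt
  have hmx : Measurable X := (Lp.stronglyMeasurable X).measurable
  have hmw : Measurable (Linv X) := (Lp.stronglyMeasurable (Linv X)).measurable
  have hx := Lp.memLp X
  have hw := Lp.memLp (Linv X)
  have hxi : Integrable X P := hx.integrable (by norm_num)
  set m := ∫ y, h y ∂(gaussianReal 0 1)
  have hfx : MemLp (fun ω => f (X ω)) 2 P :=
    MemLp.of_bound (hfc.measurable.comp hmx).aestronglyMeasurable 1 (ae_of_all _ fun ω => hfb _)
  have hf'i : Integrable (fun ω => f' (X ω)) P :=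
    Integrable.of_bound (hfc'.measurable.comp hmx).aestronglyMeasurable 1
      (ae_of_all _ fun ω => hfb' _)
  have hxf : Integrable (fun ω => X ω * f (X ω)) P := hx.integrable_mul hfx
  set T : ℕ → ℝ := fun k => ∫ ω, dif k (Linv X) ω * f (X ω) ∂P
  set e : ℕ → ℝ := fun k => ∫ ω, f' (X ω) * cov k X (Linv X) ω ∂P
  have hT : HasSum T (-∫ ω, X ω * f (X ω) ∂P) := by
    have := hasSum_inner_difLp_Linv hX0 hfx.toLp
    rw [inner_eq_integral_of_ae X hfx.coeFn_toLp] at this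
    convert this using 2 with k
    rw [inner_eq_integral_of_ae _ hfx.coeFn_toLp]
    refine integral_congr_ae ?_
    filter_upwards [coeFn_difLp k (Linv X)] with ω hω
    rw [hω]
  have hmul := tsum_lintegral_dif_mul_lt_top hmx (tsum_lintegral_dif_sq_lt_top hX)
    (tsum_lintegral_dif_Linv_sq_lt_top hX0)
  have hci : ∀ k, Integrable (fun ω => f' (X ω) * cov k X (Linv X) ω) P := fun k =>
    (integrable_cov k hmx hx hmw hw).bdd_mul (c := 1)
      (hfc'.measurable.comp hmx).aestronglyMeasurable (ae_of_all _ fun u => hfb' _)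
  have hcs : Summable fun k => ∫ ω, ‖f' (X ω) * cov k X (Linv X) ω‖ ∂P := by
    have h1 : ∑' k, ENNReal.ofReal (∫ ω, ‖f' (X ω) * cov k X (Linv X) ω‖ ∂P) ≠ ∞ := by
      refine ne_of_lt (lt_of_le_of_lt (ENNReal.tsum_le_tsum fun k => ?_) hmul)
      rw [ofReal_integral_norm_eq_lintegral_enorm (hci k)]
      refine le_trans (lintegral_mono fun ω => ?_) (lintegral_cov_le k hmx hmw)
      rw [enorm_mul]
      refine mul_le_of_le_one_left (by simp) ?_
      rw [Real.enorm_eq_ofReal_abs]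
      exact ENNReal.ofReal_le_one.2 (hfb' _)
    have h2 := ENNReal.summable_toReal h1
    refine h2.congr fun k => ?_
    exact ENNReal.toReal_ofReal (integral_nonneg fun ω => norm_nonneg _)
  have he : HasSum e (∫ ω, (∑' k, f' (X ω) * cov k X (Linv X) ω) ∂P) :=
    hasSum_integral_of_summable_integral_norm hci hcs
  have htsi : Integrable (fun ω => ∑' k, f' (X ω) * cov k X (Linv X) ω) P :=
    integrable_tsum_of_summable_integral_norm hci hcs
  have hhi : Integrable (fun ω => h (X ω)) P := by
    have : ∀ ω, h (X ω) = f' (X ω) - X ω * f (X ω) + m := fun ω => by rw [hstein]; ring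
    simp_rw [this]
    exact (hf'i.sub hxf).add (integrable_const _)
  have e1 : ∫ y, h y ∂(P.map X) - m = ∫ ω, f' (X ω) ∂P - ∫ ω, X ω * f (X ω) ∂P := by
    rw [integral_map hmx.aemeasurable hh.continuous.aestronglyMeasurable,
      ← integral_sub hf'i hxf]
    simp_rw [hstein]
    rw [integral_sub hhi (integrable_const _)]
    simp [m]
  -- The linearised series `∑ e k` is added and subtracted. With `f' (X ω)` factored out it gives
  -- the first term of the bound, and each difference `T k - e k` is a Taylor remainder.
  have e2 : ∫ y, h y ∂(P.map X) - m
      = (∫ ω, (f' (X ω) + ∑' k, f' (X ω) * cov k X (Linv X) ω) ∂P) + ∑' k, (T k - e k) := by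
    rw [e1, integral_add hf'i htsi, (hT.sub he).tsum_eq]
    ring
  rw [e2]
  refine (enorm_add_le _ _).trans (add_le_add ?_ ?_)
  · refine (enorm_integral_le_lintegral_enorm _).trans (lintegral_mono_ae ?_)
    filter_upwards [ae_integrableOn_nabla_mul hmx hmw hmul] with ω hω
    rw [half_integral_nabla_mul hω, sub_neg_eq_add, tsum_mul_left]
    have : f' (X ω) + f' (X ω) * ∑' k, cov k X (Linv X) ω
        = f' (X ω) * (1 + ∑' k, cov k X (Linv X) ω) := by ring
    rw [this, enorm_mul]
    refine mul_le_of_le_one_left (by simp) ?_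
    rw [Real.enorm_eq_ofReal_abs]
    exact ENNReal.ofReal_le_one.2 (hfb' _)
  · refine enorm_tsum_le_tsum_enorm.trans (ENNReal.tsum_le_tsum fun k => ?_)
    exact enorm_sub_le_remainder k hmx hx hmw hw hfc hfb hfc' hfb' htaylor

end UniformSeq

end

theorem proposition3p3 (X : Lp ℝ 2 UniformSeq.P) (hX : X ∈ UniformSeq.DomNabla)
    (hX0 : ∫ ω, X ω ∂UniformSeq.P = 0) :
    -- the inner product `⟨∇X, -∇L⁻¹X⟩` of `L²(ℝ₊)` is almost surely a convergent integral
    (∀ᵐ ω ∂UniformSeq.P, IntegrableOn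
      (fun t : ℝ => UniformSeq.nabla t X ω * -UniformSeq.nabla t (UniformSeq.Linv X) ω)
      (Set.Ici 0)) ∧
    UniformSeq.dW (UniformSeq.P.map X) (gaussianReal 0 1) ≤
      (∫⁻ ω, ‖1 - 1 / 2 * ∫ t in Set.Ici (0 : ℝ),
          UniformSeq.nabla t X ω * -UniformSeq.nabla t (UniformSeq.Linv X) ω‖ₑ ∂UniformSeq.P)
      + 1 / 2 * (∫⁻ ω, (∫⁻ t in Set.Ici (0 : ℝ),
          ‖UniformSeq.nabla t (UniformSeq.Linv X) ω‖ₑ * ‖UniformSeq.nabla t X ω‖ₑ ^ 2)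
          ∂UniformSeq.P)
      + 1 / 4 * (∫⁻ ω, (∫⁻ t in Set.Ici (0 : ℝ),
          ‖UniformSeq.nabla t (UniformSeq.Linv X) ω‖ₑ *
            ∫⁻ s in UniformSeq.block t, ‖UniformSeq.nabla s X ω‖ₑ ^ 2)
          ∂UniformSeq.P) := by
  have hmx : Measurable X := (Lp.stronglyMeasurable X).measurable
  have hmw : Measurable (UniformSeq.Linv X) :=
    (Lp.stronglyMeasurable (UniformSeq.Linv X)).measurable
  refine ⟨UniformSeq.ae_integrableOn_nabla_mul hmx hmw
    (UniformSeq.tsum_lintegral_dif_mul_lt_top hmx (UniformSeq.tsum_lintegral_dif_sq_lt_top hX)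
      (UniformSeq.tsum_lintegral_dif_Linv_sq_lt_top hX0)), ?_⟩
  rw [add_assoc, ← UniformSeq.tsum_remainder hmx (Lp.memLp X) hmw]
  exact iSup₂_le fun h hh => UniformSeq.enorm_integral_sub_gaussian_le hX hX0 hh
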